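/- All manifolds are smooth, Hausdorff, finite-dimensional and without boundary; they need not be connected, and the Riemannian distance between points of different components is $\infty$. A Riemannian manifold $(N,h)$ has \emph{$k$-bounded geometry} if (a) for each $i=0,\dots,k$ there is a constant $V_i$ with $|\nabla^i R(x)|\le V_i$ for all $x\in N$, where $R$ is the Riemann curvature tensor, $\nabla$ the Levi-Civita connection and $|\cdot|$ the norm of tensors induced by $h$; and (b) there is $C>0$ such that the injectivity radius satisfies $i_h(p)\ge C$ for all $p\in N$. Here $i_h(p)$ is the largest $R\in[0,\infty]$ such that for all $0<r<R$ the exponential map $\exp_p$ is defined on the ball $B_r(0)\subset T_pN$ and maps it diffeomorphically onto the ball of radius $r$ around $p$ for the Riemannian distance. $N$ has \emph{bounded geometry} if it has $k$-bounded geometry for all $k\in\mathbb N$. An action by isometries of a group $\Gamma$ on a metric space $(X,d)$ is \emph{uniformly properly discontinuous and free (FUPD)} if it is free and properly discontinuous, and there is $\delta>0$ such that for all $p\in X$ and $\gamma\in\Gamma$, $d(p,\gamma p)\le\delta$ implies $p=\gamma p$. \textbf{Proposition.} Let $(M,g)$ be a Riemannian manifold of bounded geometry and let $\Gamma$ be a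 (discrete) group acting freely on $M$ by isometries, i.e. by diffeomorphisms that preserve $g$. Then the following are equivalent: \begin{enumerate} \item the action of $\Gamma$ on $M$, with its Riemannian distance, is FUPD; \item the quotient $M/\Gamma$ has bounded geometry; that is, the orbit space $M/\Gamma$ with the quotient topology is Hausdorff and carries the structure of a smooth Riemannian manifold for which the projection $M\to M/\Gamma$ is a Riemannian covering (a smooth covering map that is a local isometry), and this Riemannian manifold has bounded geometry. \end{enumerate} -/

import Mathlib

open Set Manifold Bundle
open scoped ContDiff ENNReal Topology

noncomputable section

/-!
### Local Riemannian geometry on a finite-dimensional vector space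

`G : E → E →L[ℝ] E →L[ℝ] ℝ` is the field of coefficients of a Riemannian metric in a chart with
values in `E`.
-/

section Local

variable {E : Type*} [NormedAddCommGroup E] [NormedSpace ℝ E]

/-- The Christoffel symbols of the first kind, as the linear form
`w ↦ ½ (∂ᵤ G(v, w) + ∂ᵥ G(u, w) - ∂_w G(u, v))`. -/
def christoffelForm (G : E → E →L[ℝ] E →L[ℝ] ℝ) (y u v : E) : E →L[ℝ] ℝ :=
  (1 / 2 : ℝ) • (fderiv ℝ G y u v + fderiv ℝ G y v u - ((fderiv ℝ G y).flip u).flip v)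

/-- The Christoffel symbols of the second kind: `christoffel G y u v` is the vector `z` with
`G y z = christoffelForm G y u v`, for `G y` nondegenerate. -/
def christoffel (G : E → E →L[ℝ] E →L[ℝ] ℝ) (y u v : E) : E :=
  (G y).inverse (christoffelForm G y u v)

/-- The curvature `R(u, v) w` of the Levi-Civita connection of `G` at `y`. -/
def curvatureEndo (G : E → E →L[ℝ] E →L[ℝ] ℝ) (y u v w : E) : E :=
  fderiv ℝ (fun z => christoffel G z v w) y u - fderiv ℝ (fun z => christoffel G z u w) y v
    + christoffel G y u (christoffel G y v w) - christoffel G y v (christoffel G y u w)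

/-- The Riemann curvature tensor `Rm(a₀, a₁, a₂, a₃) = G(R(a₀, a₁) a₂, a₃)`. -/
def curvatureTensor (G : E → E →L[ℝ] E →L[ℝ] ℝ) (y : E) (a : Fin 4 → E) : ℝ :=
  G y (curvatureEndo G y (a 0) (a 1) (a 2)) (a 3)

/-- The Levi-Civita covariant derivative of a covariant tensor field `T` of order `m`; the
direction of differentiation is the first argument of the new tensor:
`(∇T)(a₀, …, aₘ) = ∂_{a₀} (T(a₁, …, aₘ)) - ∑ⱼ T(a₁, …, Γ(a₀, aⱼ), …, aₘ)`. -/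
def covDeriv (G : E → E →L[ℝ] E →L[ℝ] ℝ) {m : ℕ} (T : E → (Fin m → E) → ℝ)
    (y : E) (a : Fin (m + 1) → E) : ℝ :=
  fderiv ℝ (fun z => T z (Fin.tail a)) y (a 0)
    - ∑ j : Fin m, T y (Function.update (Fin.tail a) j (christoffel G y (a 0) (Fin.tail a j)))

/-- The `i`-th iterated covariant derivative `∇ⁱ Rm` of the Riemann curvature tensor. -/
def iteratedCovDerivCurvature (G : E → E →L[ℝ] E →L[ℝ] ℝ) :
    (i : ℕ) → E → (Fin (4 + i) → E) → ℝ
  | 0 => curvatureTensor G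
  | i + 1 => covDeriv G (iteratedCovDerivCurvature G i)

end Local

/-! ### Riemannian manifolds -/

section Riemannian

variable {E : Type*} [NormedAddCommGroup E] [NormedSpace ℝ E]
  {M : Type*} [TopologicalSpace M] [ChartedSpace E M] [IsManifold 𝓘(ℝ, E) ∞ M]
  [RiemannianBundle (fun x : M => TangentSpace 𝓘(ℝ, E) x)]

/-- The coefficients of the Riemannian metric in the chart `e`. -/
def metricInChart (e : OpenPartialHomeomorph M E) (y : E) : E →L[ℝ] E →L[ℝ] ℝ :=
  (innerSL ℝ (E := TangentSpace 𝓘(ℝ, E) (e.symm y))).bilinearComp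
    (mfderiv 𝓘(ℝ, E) 𝓘(ℝ, E) e.symm y) (mfderiv 𝓘(ℝ, E) 𝓘(ℝ, E) e.symm y)

/-- `|∇ⁱ Rm (x)| ≤ V`: the norm at `x`, as a multilinear form on the tangent space with its
Riemannian norm, of the `i`-th covariant derivative of the curvature tensor is at most `V`.
By tensoriality the condition is the same in all smooth charts around `x`. -/
def CurvatureDerivNormLE (E : Type*) [NormedAddCommGroup E] [NormedSpace ℝ E]
    {M : Type*} [TopologicalSpace M] [ChartedSpace E M]
    [RiemannianBundle (fun x : M => TangentSpace 𝓘(ℝ, E) x)] (i : ℕ) (x : M) (V : ℝ) : Prop :=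
  ∀ e ∈ IsManifold.maximalAtlas 𝓘(ℝ, E) ∞ M, x ∈ e.source → ∀ a : Fin (4 + i) → E,
    |iteratedCovDerivCurvature (metricInChart e) i (e x) a|
      ≤ V * ∏ j, √(metricInChart e (e x) (a j) (a j))

/-- `c` is a (smooth, affinely parametrized) geodesic on the open set `J ⊆ ℝ`: in all smooth
charts it satisfies `c'' + Γ(c', c') = 0`. -/
def IsGeodesicOn (E : Type*) [NormedAddCommGroup E] [NormedSpace ℝ E]
    {M : Type*} [TopologicalSpace M] [ChartedSpace E M]
    [RiemannianBundle (fun x : M => TangentSpace 𝓘(ℝ, E) x)] (c : ℝ → M) (J : Set ℝ) : Prop :=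
  ContMDiffOn 𝓘(ℝ, ℝ) 𝓘(ℝ, E) ∞ c J ∧
    ∀ t ∈ J, ∀ e ∈ IsManifold.maximalAtlas 𝓘(ℝ, E) ∞ M, c t ∈ e.source →
      deriv (deriv (e ∘ c)) t +
        christoffel (metricInChart e) (e (c t)) (deriv (e ∘ c) t) (deriv (e ∘ c) t) = 0

/-- `c` is a geodesic, defined on an open interval that contains `[0, 1]`, that starts at `p` with
velocity `v`. -/
def IsGeodesicFrom (p : M) (v : TangentSpace 𝓘(ℝ, E) p) (c : ℝ → M) : Prop :=
  (∃ J : Set ℝ, IsOpen J ∧ J.OrdConnected ∧ Icc 0 1 ⊆ J ∧ IsGeodesicOn E c J) ∧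
    (⟨c 0, mfderiv 𝓘(ℝ, ℝ) 𝓘(ℝ, E) c 0 (1 : ℝ)⟩ : TangentBundle 𝓘(ℝ, E) M) = ⟨p, v⟩

open Classical in
/-- The Riemannian exponential map `exp_p v = c 1`, where `c` is the geodesic with `c 0 = p` and
`c' 0 = v`; the value is `p` if there is no such geodesic on `[0, 1]`. -/
def riemannianExp (p : M) (v : TangentSpace 𝓘(ℝ, E) p) : M :=
  if h : ∃ c : ℝ → M, IsGeodesicFrom p v c then h.choose 1 else p

/-- The exponential map at `p` is defined on the ball of radius `r` around `0` in the tangent space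
(for the Riemannian norm), and is a smooth diffeomorphism of this ball onto the ball of radius `r`
around `p` for the Riemannian distance. The tangent space is `E` as a topological vector space, so
smoothness refers to `E`. -/
def ExpIsDiffeoOnBall (E : Type*) [NormedAddCommGroup E] [NormedSpace ℝ E]
    {M : Type*} [TopologicalSpace M] [ChartedSpace E M]
    [RiemannianBundle (fun x : M => TangentSpace 𝓘(ℝ, E) x)] (p : M) (r : ℝ) : Prop :=
  (∀ v : TangentSpace 𝓘(ℝ, E) p, ‖v‖ < r → ∃ c : ℝ → M, IsGeodesicFrom p v c) ∧
    ∃ Φ : PartialDiffeomorph 𝓘(ℝ, E) 𝓘(ℝ, E) E M ∞,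
      Φ.source = {v : TangentSpace 𝓘(ℝ, E) p | ‖v‖ < r} ∧
      Φ.target = {q : M | riemannianEDist 𝓘(ℝ, E) p q < ENNReal.ofReal r} ∧
      ∀ v : TangentSpace 𝓘(ℝ, E) p, ‖v‖ < r → Φ v = riemannianExp p v

/-- The injectivity radius at `p`: the largest `R` such that, for all `0 < r < R`, the exponential
map at `p` is a diffeomorphism of the ball of radius `r` in the tangent space onto the ball of
radius `r` around `p`. -/
def injectivityRadius (E : Type*) [NormedAddCommGroup E] [NormedSpace ℝ E]
    {M : Type*} [TopologicalSpace M] [ChartedSpace E M]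
    [RiemannianBundle (fun x : M => TangentSpace 𝓘(ℝ, E) x)] (p : M) : ℝ≥0∞ :=
  sSup {R : ℝ≥0∞ | ∀ r : ℝ, 0 < r → ENNReal.ofReal r < R → ExpIsDiffeoOnBall E p r}

/-- The Riemannian manifold `M` has `k`-bounded geometry. -/
def HasBoundedGeometryOfOrder (E : Type*) [NormedAddCommGroup E] [NormedSpace ℝ E]
    (M : Type*) [TopologicalSpace M] [ChartedSpace E M]
    [RiemannianBundle (fun x : M => TangentSpace 𝓘(ℝ, E) x)] (k : ℕ) : Prop :=
  (∀ i ≤ k, ∃ V : ℝ, ∀ x : M, CurvatureDerivNormLE E i x V) ∧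
    ∃ C : ℝ, 0 < C ∧ ∀ p : M, ENNReal.ofReal C ≤ injectivityRadius E p

/-- The Riemannian manifold `M` has bounded geometry (of all orders). -/
def HasBoundedGeometry (E : Type*) [NormedAddCommGroup E] [NormedSpace ℝ E]
    (M : Type*) [TopologicalSpace M] [ChartedSpace E M]
    [RiemannianBundle (fun x : M => TangentSpace 𝓘(ℝ, E) x)] : Prop :=
  ∀ k : ℕ, HasBoundedGeometryOfOrder E M k

/-- `f` is a Riemannian covering: a smooth covering map that is a local isometry. -/
structure IsRiemannianCovering (E : Type*) [NormedAddCommGroup E] [NormedSpace ℝ E]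
    {M N : Type*} [TopologicalSpace M] [ChartedSpace E M]
    [RiemannianBundle (fun x : M => TangentSpace 𝓘(ℝ, E) x)]
    [TopologicalSpace N] [ChartedSpace E N]
    [RiemannianBundle (fun x : N => TangentSpace 𝓘(ℝ, E) x)] (f : M → N) : Prop where
  isCoveringMap : IsCoveringMap f
  isLocalDiffeomorph : IsLocalDiffeomorph 𝓘(ℝ, E) 𝓘(ℝ, E) ∞ f
  inner_mfderiv : ∀ (x : M) (v w : TangentSpace 𝓘(ℝ, E) x),
    inner ℝ (mfderiv 𝓘(ℝ, E) 𝓘(ℝ, E) f x v) (mfderiv 𝓘(ℝ, E) 𝓘(ℝ, E) f x w) = inner ℝ v w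

/-- The group `Γ` acts on the Riemannian manifold `M` by (Riemannian) isometries. The inverse of
the diffeomorphism `γ • ·` is `γ⁻¹ • ·`. -/
structure ActsByIsometries (E : Type*) [NormedAddCommGroup E] [NormedSpace ℝ E]
    (Γ M : Type*) [Group Γ] [TopologicalSpace M] [ChartedSpace E M]
    [RiemannianBundle (fun x : M => TangentSpace 𝓘(ℝ, E) x)] [MulAction Γ M] : Prop where
  contMDiff_smul : ∀ γ : Γ, ContMDiff 𝓘(ℝ, E) 𝓘(ℝ, E) ∞ (fun x : M => γ • x)
  inner_mfderiv_smul : ∀ (γ : Γ) (x : M) (v w : TangentSpace 𝓘(ℝ, E) x),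
    inner ℝ (mfderiv 𝓘(ℝ, E) 𝓘(ℝ, E) (fun x : M => γ • x) x v)
      (mfderiv 𝓘(ℝ, E) 𝓘(ℝ, E) (fun x : M => γ • x) x w) = inner ℝ v w

/-- The orbit space `M / Γ`, with the quotient topology, is a Riemannian manifold (the smooth
structure and the metric being those that make the projection a Riemannian covering), and this
Riemannian manifold has bounded geometry. -/
def QuotientHasBoundedGeometry (E : Type*) [NormedAddCommGroup E] [NormedSpace ℝ E]
    (Γ M : Type*) [Group Γ] [TopologicalSpace M] [ChartedSpace E M]
    [RiemannianBundle (fun x : M => TangentSpace 𝓘(ℝ, E) x)] [MulAction Γ M] : Prop :=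
  T2Space (MulAction.orbitRel.Quotient Γ M) ∧
  ∃ (_ : ChartedSpace E (MulAction.orbitRel.Quotient Γ M))
    (_ : IsManifold 𝓘(ℝ, E) ∞ (MulAction.orbitRel.Quotient Γ M))
    (_ : RiemannianBundle
      (fun q : MulAction.orbitRel.Quotient Γ M => TangentSpace 𝓘(ℝ, E) q)),
    IsContMDiffRiemannianBundle 𝓘(ℝ, E) ∞ E
      (fun q : MulAction.orbitRel.Quotient Γ M => TangentSpace 𝓘(ℝ, E) q) ∧
    IsRiemannianCovering E (Quotient.mk _ : M → MulAction.orbitRel.Quotient Γ M) ∧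
    HasBoundedGeometry E (MulAction.orbitRel.Quotient Γ M)

end Riemannian

/-- An (isometric) action of a group on a metric space is uniformly properly discontinuous and
free (FUPD). -/
structure IsFUPD (Γ X : Type*) [Group Γ] [EMetricSpace X] [MulAction Γ X] : Prop where
  free : ∀ (γ : Γ) (p : X), γ • p = p → γ = 1
  properlyDiscontinuous : ProperlyDiscontinuousSMul Γ X
  uniform : ∃ δ : ℝ, 0 < δ ∧ ∀ (p : X) (γ : Γ), edist p (γ • p) ≤ ENNReal.ofReal δ → p = γ • p

end

/-!
The projection `π : M → M / Γ` is a Riemannian covering as soon as the quotient is a Riemannian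
manifold at all, so the equivalence is a comparison of the geometries of the source and the target
of a surjective Riemannian covering.

A local isometry `f` is, near each point, a change of charts that preserves the metric
coefficients. Hence it preserves the bounds on the derivatives of the curvature and maps geodesics
to geodesics. As geodesics are determined by their initial velocity (`IsGeodesicFrom.eq_one`, from
uniqueness for the geodesic equation in a chart and connectedness of the interval), this gives
`f (exp_p v) = exp_{f p} (df v)`, which is `IsRiemannianLocalIsometry.riemannianExp_mfderiv`.

Suppose that the action is FUPD with constant `δ`. The projection is a covering by a free and
properly discontinuous action, and the quotient inherits charts
(`IsQuotientCoveringMap.exists_isManifold`) and, the action being isometric, the metric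
(`IsLocalDiffeomorph.exists_riemannianBundle`). Two points in a ball of radius `r < δ / 2` with the
same image are equal, and `π` maps the ball of radius `r` around `p` onto the one around `π p` by
lifting of paths (`IsRiemannianCovering.exists_riemannianEDist_lt`). So if `exp_p` is a
diffeomorphism on the ball of radius `r`, then so is `exp_{π p} = π ∘ exp_p ∘ (dπ)⁻¹`
(`IsRiemannianCovering.expIsDiffeoOnBall`), and the injectivity radius of the quotient is at least
`min C (δ / 2)` (`IsRiemannianCovering.hasBoundedGeometry`).

Conversely, let the injectivity radii of `M` and `M / Γ` be larger than `r`, and let `γ p` have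
distance less than `r` from `p`. Then `γ p = exp_p v` with `|v| < r`, and both `dπ v` and `0` are
mapped to `π p` by the exponential map at `π p`; hence `v = 0` and `γ p = p`
(`IsRiemannianLocalIsometry.eq_of_riemannianEDist_lt`). Proper discontinuity follows from this
uniform bound by compactness (`properlyDiscontinuousSMul_of_uniform`).
-/

set_option maxSynthPendingDepth 3

/-! ### Local analysis of the geodesic equation -/

section LocalAnalysis

open Filter

variable {E : Type*} [NormedAddCommGroup E] [NormedSpace ℝ E]

lemma christoffel_eventuallyEq {G G' : E → E →L[ℝ] E →L[ℝ] ℝ} {y : E} (h : G =ᶠ[𝓝 y] G') :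
    christoffel G =ᶠ[𝓝 y] christoffel G' := by
  filter_upwards [h.eventuallyEq_nhds] with z hz
  ext u v
  simp only [christoffel, christoffelForm, hz.fderiv_eq, hz.eq_of_nhds]

lemma curvatureTensor_eventuallyEq {G G' : E → E →L[ℝ] E →L[ℝ] ℝ} {y : E} (h : G =ᶠ[𝓝 y] G') :
    curvatureTensor G =ᶠ[𝓝 y] curvatureTensor G' := by
  filter_upwards [h.eventuallyEq_nhds] with z hz
  ext a
  have hc := christoffel_eventuallyEq hz
  have hd (u v : E) : fderiv ℝ (fun x => christoffel G x u v) z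
      = fderiv ℝ (fun x => christoffel G' x u v) z :=
    EventuallyEq.fderiv_eq (hc.mono fun x hx => by simp only [hx])
  simp only [curvatureTensor, curvatureEndo, hd, hc.eq_of_nhds, hz.eq_of_nhds]

lemma covDeriv_eventuallyEq {G G' : E → E →L[ℝ] E →L[ℝ] ℝ} {m : ℕ} {T T' : E → (Fin m → E) → ℝ}
    {y : E} (h : G =ᶠ[𝓝 y] G') (hT : T =ᶠ[𝓝 y] T') :
    covDeriv G T =ᶠ[𝓝 y] covDeriv G' T' := by
  filter_upwards [h.eventuallyEq_nhds, hT.eventuallyEq_nhds] with z hz hTz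
  ext a
  have hd (b : Fin m → E) : fderiv ℝ (fun x => T x b) z = fderiv ℝ (fun x => T' x b) z :=
    EventuallyEq.fderiv_eq (hTz.mono fun x hx => by simp only [hx])
  simp only [covDeriv, hd, (christoffel_eventuallyEq hz).eq_of_nhds, hTz.eq_of_nhds]

/-- The covariant derivatives of the curvature depend only on the germ of the metric. -/
lemma iteratedCovDerivCurvature_eventuallyEq {G G' : E → E →L[ℝ] E →L[ℝ] ℝ} {y : E}
    (h : G =ᶠ[𝓝 y] G') (i : ℕ) :
    iteratedCovDerivCurvature G i =ᶠ[𝓝 y] iteratedCovDerivCurvature G' i := by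
  induction i with
  | zero => exact curvatureTensor_eventuallyEq h
  | succ i ih => exact covDeriv_eventuallyEq h ih

/-- A positive definite bilinear form on a finite-dimensional space is invertible as a map to the
dual. -/
lemma isInvertible_of_pos [FiniteDimensional ℝ E] {B : E →L[ℝ] E →L[ℝ] ℝ}
    (hB : ∀ v, v ≠ 0 → 0 < B v v) : B.IsInvertible := by
  have hinj : Function.Injective B := by
    rw [injective_iff_map_eq_zero]
    intro v hv
    by_contra h
    simpa [hv] using hB v h
  have hdim : Module.finrank ℝ E = Module.finrank ℝ (E →L[ℝ] ℝ) := by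
    rw [← (LinearMap.toContinuousLinearMap (𝕜 := ℝ) (E := E) (F' := ℝ)).finrank_eq]
    exact (Subspace.dual_finrank_eq (K := ℝ) (V := E)).symm
  let e : E ≃ₗ[ℝ] (E →L[ℝ] ℝ) := LinearEquiv.ofInjectiveOfFinrankEq B.toLinearMap hinj hdim
  exact ⟨e.toContinuousLinearEquiv, by ext v w; rfl⟩

lemma ContDiffAt.clm_flip {X A B C : Type*} [NormedAddCommGroup X] [NormedSpace ℝ X]
    [NormedAddCommGroup A] [NormedSpace ℝ A] [NormedAddCommGroup B] [NormedSpace ℝ B]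
    [NormedAddCommGroup C] [NormedSpace ℝ C] {n : WithTop ℕ∞} {f : X → A →L[ℝ] B →L[ℝ] C} {x : X}
    (hf : ContDiffAt ℝ n f x) : ContDiffAt ℝ n (fun p => (f p).flip) x :=
  (ContinuousLinearMap.flipₗᵢ ℝ A B C).contDiff.contDiffAt.comp x hf

/-- The right-hand side of the geodesic equation is smooth where the metric is smooth and positive
definite. -/
lemma contDiffAt_christoffel [FiniteDimensional ℝ E] {G : E → E →L[ℝ] E →L[ℝ] ℝ} {y v : E}
    (hG : ContDiffAt ℝ ∞ G y) (hpos : ∀ v, v ≠ 0 → 0 < G y v v) :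
    ContDiffAt ℝ 1 (fun p : E × E => christoffel G p.1 p.2 p.2) (y, v) := by
  have hG1 : ContDiffAt ℝ 1 (fun p : E × E => G p.1) (y, v) :=
    (hG.of_le (by simp)).comp (y, v) contDiffAt_fst
  have hd : ContDiffAt ℝ 1 (fun p : E × E => fderiv ℝ G p.1) (y, v) :=
    (hG.fderiv_right (m := 1) (by rw [one_add_one_eq_two]; exact ENat.LEInfty.out)).comp
      (y, v) contDiffAt_fst
  have hs : ContDiffAt ℝ 1 (fun p : E × E => p.2) (y, v) := contDiffAt_snd
  have hinv : ContDiffAt ℝ 1 (fun p : E × E => (G p.1).inverse) (y, v) :=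
    ContDiffAt.comp (g := ContinuousLinearMap.inverse) (y, v)
      (isInvertible_of_pos hpos).contDiffAt_map_inverse hG1
  unfold christoffel christoffelForm
  refine hinv.clm_apply (ContDiffAt.const_smul _ ?_)
  exact (((hd.clm_apply hs).clm_apply hs).add ((hd.clm_apply hs).clm_apply hs)).sub
    ((hd.clm_flip.clm_apply hs).clm_flip.clm_apply hs)

/-- Local uniqueness for the autonomous second-order equation `u'' = F (u, u')`. -/
lemma eventuallyEq_of_second_order_ode {F : E × E → E} {u₁ u₂ : ℝ → E} {t₀ : ℝ}
    (hF : ContDiffAt ℝ 1 F (u₁ t₀, deriv u₁ t₀))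
    (h₁ : ContDiffAt ℝ ∞ u₁ t₀) (h₂ : ContDiffAt ℝ ∞ u₂ t₀)
    (e₁ : ∀ᶠ t in 𝓝 t₀, deriv (deriv u₁) t = F (u₁ t, deriv u₁ t))
    (e₂ : ∀ᶠ t in 𝓝 t₀, deriv (deriv u₂) t = F (u₂ t, deriv u₂ t))
    (h0 : u₁ t₀ = u₂ t₀) (h0' : deriv u₁ t₀ = deriv u₂ t₀) :
    u₁ =ᶠ[𝓝 t₀] u₂ := by
  have hV : ContDiffAt ℝ 1 (fun p : E × E => (p.2, F p)) (u₁ t₀, deriv u₁ t₀) :=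
    contDiffAt_snd.prodMk hF
  obtain ⟨K, s, hs, hK⟩ := hV.exists_lipschitzOnWith
  have key {u : ℝ → E} (h : ContDiffAt ℝ ∞ u t₀)
      (e : ∀ᶠ t in 𝓝 t₀, deriv (deriv u) t = F (u t, deriv u t))
      (h0 : (u t₀, deriv u t₀) = (u₁ t₀, deriv u₁ t₀)) :
      ∀ᶠ t in 𝓝 t₀, HasDerivAt (fun t => (u t, deriv u t)) (deriv u t, F (u t, deriv u t)) t ∧
        (u t, deriv u t) ∈ s := by
    have hd : ContDiffAt ℝ 1 (deriv u) t₀ := by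
      have := (h.fderiv_right (m := 1) (by rw [one_add_one_eq_two]; exact ENat.LEInfty.out)).clm_apply
        (contDiffAt_const (c := (1 : ℝ)))
      simpa using this
    have hcont : ContinuousAt (fun t => (u t, deriv u t)) t₀ :=
      h.continuousAt.prodMk hd.continuousAt
    have hu : ∀ᶠ t in 𝓝 t₀, ContDiffAt ℝ 1 u t := (h.of_le (by simp)).eventually (by simp)
    filter_upwards [e, hu, hd.eventually (by simp),
      hcont.preimage_mem_nhds (by simpa only [h0] using hs)] with t h1 h2 h3 h4
    refine ⟨?_, h4⟩
    rw [← h1]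
    exact (h2.differentiableAt (by simp)).hasDerivAt.prodMk
      (h3.differentiableAt (by simp)).hasDerivAt
  have := ODE_solution_unique_of_eventually (v := fun _ p => (p.2, F p)) (s := fun _ => s)
    (Eventually.of_forall fun _ => hK) (key h₁ e₁ rfl) (key h₂ e₂ (by rw [h0, h0']))
    (by simp only [h0, h0'])
  exact this.mono fun t ht => congrArg Prod.fst ht

end LocalAnalysis

/-! ### Local diffeomorphisms -/

section LocalDiffeomorphism

variable {E : Type*} [NormedAddCommGroup E] [NormedSpace ℝ E]
  {M : Type*} [TopologicalSpace M] [ChartedSpace E M]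
  {N : Type*} [TopologicalSpace N] [ChartedSpace E N] {f : M → N}

/-- A chart `e` of the target of a local diffeomorphism `f` pulls back to the chart `e ∘ f` of the
source, after shrinking its domain around a given point. -/
lemma IsLocalDiffeomorph.exists_pullback_chart [IsManifold 𝓘(ℝ, E) ∞ M]
    (hf : IsLocalDiffeomorph 𝓘(ℝ, E) 𝓘(ℝ, E) ∞ f)
    {e : OpenPartialHomeomorph N E} (he : e ∈ IsManifold.maximalAtlas 𝓘(ℝ, E) ∞ N) {x : M}
    (hx : f x ∈ e.source) :
    ∃ e' ∈ IsManifold.maximalAtlas 𝓘(ℝ, E) ∞ M, x ∈ e'.source ∧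
      (∀ y ∈ e'.source, e' y = e (f y)) ∧ e'.target ⊆ e.target ∧
      ∀ z ∈ e'.target, f (e'.symm z) = e.symm z := by
  obtain ⟨Φ, hxΦ, hΦ⟩ := hf x
  have hsource : (Φ.toOpenPartialHomeomorph.trans e).source ⊆ Φ.source := fun y hy => hy.1
  have htarget : (Φ.toOpenPartialHomeomorph.trans e).target ⊆ e.target := fun z hz => hz.1
  refine ⟨Φ.toOpenPartialHomeomorph.trans e,
    OpenPartialHomeomorph.mem_maximalAtlas_of_contMDiffOn _ ?_ ?_, ?_, ?_, htarget, ?_⟩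
  · exact (contMDiffOn_of_mem_maximalAtlas he).comp (Φ.contMDiffOn_toFun.mono hsource)
      fun y hy => hy.2
  · exact Φ.contMDiffOn_invFun.comp ((contMDiffOn_symm_of_mem_maximalAtlas he).mono htarget)
      fun y hy => hy.2
  · exact ⟨hxΦ, by simpa [PartialDiffeomorph.toOpenPartialHomeomorph, ← hΦ hxΦ] using hx⟩
  · intro y hy
    rw [hΦ (hsource hy)]
    rfl
  · intro z hz
    have h1 : e.symm z ∈ Φ.target := hz.2
    have h2 : Φ.symm (e.symm z) ∈ Φ.source := Φ.map_target h1
    change f (Φ.symm (e.symm z)) = e.symm z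
    rw [hΦ h2]
    exact Φ.right_inv h1

/-- A local diffeomorphism that is injective on an open set restricts to a diffeomorphism of this
set onto its image. -/
lemma IsLocalDiffeomorph.exists_partialDiffeomorph_of_injOn [Nonempty M]
    (hf : IsLocalDiffeomorph 𝓘(ℝ, E) 𝓘(ℝ, E) ∞ f) {U : Set M} (hU : IsOpen U) (hinj : InjOn f U) :
    ∃ Ψ : PartialDiffeomorph 𝓘(ℝ, E) 𝓘(ℝ, E) M N ∞,
      Ψ.source = U ∧ Ψ.target = f '' U ∧ ⇑Ψ = f := by
  let e := hinj.toPartialEquiv f U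
  refine ⟨⟨e, hU, hf.isOpenMap U hU, hf.contMDiff.contMDiffOn, ?_⟩, rfl, rfl, rfl⟩
  rintro _ ⟨x, hx, rfl⟩
  obtain ⟨Φ, hxΦ, hΦ⟩ := hf x
  have hfx : f x ∈ Φ.target := hΦ hxΦ ▸ Φ.map_source hxΦ
  have hsm := Φ.contMDiffOn_invFun.contMDiffAt (Φ.open_target.mem_nhds hfx)
  have hev : ∀ᶠ z in 𝓝 (f x), e.symm z = Φ.symm z := by
    filter_upwards [(hf.isOpenMap _ (hU.inter Φ.open_source)).mem_nhds ⟨x, ⟨hx, hxΦ⟩, rfl⟩]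
    rintro _ ⟨w, ⟨hwU, hwΦ⟩, rfl⟩
    have h1 : e.symm (f w) = w := e.left_inv hwU
    have h2 : Φ.symm (Φ w) = w := Φ.left_inv hwΦ
    rw [h1, hΦ hwΦ, h2]
  exact (hsm.congr_of_eventuallyEq hev).contMDiffWithinAt

end LocalDiffeomorphism

/-! ### Local isometries -/

section LocalIsometry

open Filter

variable {E : Type*} [NormedAddCommGroup E] [NormedSpace ℝ E]
  {M : Type*} [TopologicalSpace M] [ChartedSpace E M]
  [RiemannianBundle (fun x : M => TangentSpace 𝓘(ℝ, E) x)]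
  {N : Type*} [TopologicalSpace N] [ChartedSpace E N]
  [RiemannianBundle (fun x : N => TangentSpace 𝓘(ℝ, E) x)]

/-- A smooth local diffeomorphism that preserves the Riemannian metrics. -/
structure IsRiemannianLocalIsometry (E : Type*) [NormedAddCommGroup E] [NormedSpace ℝ E]
    {M N : Type*} [TopologicalSpace M] [ChartedSpace E M]
    [RiemannianBundle (fun x : M => TangentSpace 𝓘(ℝ, E) x)]
    [TopologicalSpace N] [ChartedSpace E N]
    [RiemannianBundle (fun x : N => TangentSpace 𝓘(ℝ, E) x)] (f : M → N) : Prop where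
  isLocalDiffeomorph : IsLocalDiffeomorph 𝓘(ℝ, E) 𝓘(ℝ, E) ∞ f
  inner_mfderiv : ∀ (x : M) (v w : TangentSpace 𝓘(ℝ, E) x),
    inner ℝ (mfderiv 𝓘(ℝ, E) 𝓘(ℝ, E) f x v) (mfderiv 𝓘(ℝ, E) 𝓘(ℝ, E) f x w) = inner ℝ v w

lemma IsRiemannianCovering.isRiemannianLocalIsometry {f : M → N} (hf : IsRiemannianCovering E f) :
    IsRiemannianLocalIsometry E f :=
  ⟨hf.isLocalDiffeomorph, hf.inner_mfderiv⟩

lemma metricInChart_apply (e : OpenPartialHomeomorph M E) (y u v : E) :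
    metricInChart e y u v = inner ℝ (mfderiv 𝓘(ℝ, E) 𝓘(ℝ, E) e.symm y u)
      (mfderiv 𝓘(ℝ, E) 𝓘(ℝ, E) e.symm y v) :=
  rfl

namespace IsRiemannianLocalIsometry

variable {f : M → N}

lemma contMDiff (hf : IsRiemannianLocalIsometry E f) : ContMDiff 𝓘(ℝ, E) 𝓘(ℝ, E) ∞ f :=
  hf.isLocalDiffeomorph.contMDiff

lemma mdifferentiableAt (hf : IsRiemannianLocalIsometry E f) (x : M) :
    MDifferentiableAt 𝓘(ℝ, E) 𝓘(ℝ, E) f x :=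
  hf.isLocalDiffeomorph.mdifferentiable (by simp) x

lemma norm_mfderiv (hf : IsRiemannianLocalIsometry E f) (x : M) (v : TangentSpace 𝓘(ℝ, E) x) :
    ‖mfderiv 𝓘(ℝ, E) 𝓘(ℝ, E) f x v‖ = ‖v‖ := by
  rw [norm_eq_sqrt_real_inner, norm_eq_sqrt_real_inner, hf.inner_mfderiv]

/-- A local isometry preserves the coefficients of the metric in corresponding charts, which is why
it preserves every notion defined through them. -/
lemma metricInChart_eqOn (hf : IsRiemannianLocalIsometry E f) [IsManifold 𝓘(ℝ, E) ∞ M]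
    {e : OpenPartialHomeomorph N E} {e' : OpenPartialHomeomorph M E}
    (he' : e' ∈ IsManifold.maximalAtlas 𝓘(ℝ, E) ∞ M)
    (hsymm : ∀ z ∈ e'.target, f (e'.symm z) = e.symm z) :
    EqOn (metricInChart e') (metricInChart e) e'.target := by
  intro z hz
  have hev : e.symm =ᶠ[𝓝 z] f ∘ e'.symm := by
    filter_upwards [e'.open_target.mem_nhds hz] with w hw using (hsymm w hw).symm
  have hd : mfderiv 𝓘(ℝ, E) 𝓘(ℝ, E) (f ∘ e'.symm) z
      = (mfderiv 𝓘(ℝ, E) 𝓘(ℝ, E) f (e'.symm z)).comp (mfderiv 𝓘(ℝ, E) 𝓘(ℝ, E) e'.symm z) :=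
    mfderiv_comp z (hf.mdifferentiableAt _)
      ((contMDiffAt_symm_of_mem_maximalAtlas he' hz).mdifferentiableAt (by simp))
  ext u v
  rw [metricInChart_apply, metricInChart_apply, ← hf.inner_mfderiv]
  -- `e.symm z` is equal to `f (e'.symm z)` only propositionally, so the tangent spaces at these
  -- points are identified by substituting a variable base point.
  have key : ∀ q, q = f (e'.symm z) → ∀ D : E →L[ℝ] TangentSpace 𝓘(ℝ, E) q,
      D = (mfderiv 𝓘(ℝ, E) 𝓘(ℝ, E) f (e'.symm z)).comp (mfderiv 𝓘(ℝ, E) 𝓘(ℝ, E) e'.symm z) →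
      (inner ℝ (D u) (D v) : ℝ) = inner ℝ
        (mfderiv 𝓘(ℝ, E) 𝓘(ℝ, E) f (e'.symm z) (mfderiv 𝓘(ℝ, E) 𝓘(ℝ, E) e'.symm z u))
        (mfderiv 𝓘(ℝ, E) 𝓘(ℝ, E) f (e'.symm z) (mfderiv 𝓘(ℝ, E) 𝓘(ℝ, E) e'.symm z v)) := by
    rintro q rfl D rfl
    rfl
  exact (key _ (hsymm z hz).symm _ (hev.mfderiv_eq.trans hd)).symm

/-- Local isometries transport bounds for the derivatives of the curvature. -/
lemma curvatureDerivNormLE (hf : IsRiemannianLocalIsometry E f) [IsManifold 𝓘(ℝ, E) ∞ M]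
    {i : ℕ} {x : M} {V : ℝ} (h : CurvatureDerivNormLE E i x V) :
    CurvatureDerivNormLE E i (f x) V := by
  intro e he hx a
  obtain ⟨e', he', hxe', hval, -, hsymm⟩ := hf.isLocalDiffeomorph.exists_pullback_chart he hx
  have hG := hf.metricInChart_eqOn he' hsymm
  have hmem : e (f x) ∈ e'.target := hval x hxe' ▸ e'.map_source hxe'
  have := h e' he' hxe' a
  rw [hval x hxe', hG hmem, (iteratedCovDerivCurvature_eventuallyEq
    (hG.eventuallyEq_of_mem (e'.open_target.mem_nhds hmem)) i).eq_of_nhds] at this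
  exact this

/-- Local isometries map geodesics to geodesics. -/
lemma isGeodesicOn_comp (hf : IsRiemannianLocalIsometry E f) [IsManifold 𝓘(ℝ, E) ∞ M]
    {c : ℝ → M} {J : Set ℝ} (hJ : IsOpen J) (hc : IsGeodesicOn E c J) :
    IsGeodesicOn E (f ∘ c) J := by
  refine ⟨hf.contMDiff.comp_contMDiffOn hc.1, fun t ht e he hte => ?_⟩
  obtain ⟨e', he', hxe', hval, -, hsymm⟩ := hf.isLocalDiffeomorph.exists_pullback_chart he hte
  have hG := hf.metricInChart_eqOn he' hsymm
  have hmem : e (f (c t)) ∈ e'.target := hval _ hxe' ▸ e'.map_source hxe'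
  have hcont : ContinuousAt c t := (hc.1.continuousOn).continuousAt (hJ.mem_nhds ht)
  have hev : e ∘ f ∘ c =ᶠ[𝓝 t] e' ∘ c := by
    filter_upwards [hcont.preimage_mem_nhds (e'.open_source.mem_nhds hxe')] with s hs
    exact (hval _ hs).symm
  have := hc.2 t ht e' he' hxe'
  rw [hval _ hxe', (christoffel_eventuallyEq
    (hG.eventuallyEq_of_mem (e'.open_target.mem_nhds hmem))).eq_of_nhds] at this
  rw [hev.deriv.deriv_eq, hev.deriv_eq]
  exact this

lemma isGeodesicFrom_comp (hf : IsRiemannianLocalIsometry E f) [IsManifold 𝓘(ℝ, E) ∞ M]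
    {c : ℝ → M} {p : M} {v : TangentSpace 𝓘(ℝ, E) p} (hc : IsGeodesicFrom p v c) :
    IsGeodesicFrom (f p) (mfderiv 𝓘(ℝ, E) 𝓘(ℝ, E) f p v) (f ∘ c) := by
  obtain ⟨⟨J, hJ, hJc, hJ1, hgeo⟩, h0⟩ := hc
  refine ⟨⟨J, hJ, hJc, hJ1, hf.isGeodesicOn_comp hJ hgeo⟩, ?_⟩
  have hd : MDifferentiableAt 𝓘(ℝ, ℝ) 𝓘(ℝ, E) c 0 :=
    (hgeo.1.contMDiffAt (hJ.mem_nhds (hJ1 (by simp)))).mdifferentiableAt (by simp)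
  have h1 := congrArg (tangentMap 𝓘(ℝ, E) 𝓘(ℝ, E) f) h0
  rw [mfderiv_comp 0 (hf.mdifferentiableAt _) hd]
  exact h1

end IsRiemannianLocalIsometry

end LocalIsometry

/-! ### Uniqueness of geodesics -/

section GeodesicUniqueness

open Filter

variable {E : Type*} [NormedAddCommGroup E] [NormedSpace ℝ E]
  {M : Type*} [TopologicalSpace M] [ChartedSpace E M]

lemma contMDiffOn_mfderiv_symm_apply [IsManifold 𝓘(ℝ, E) ∞ M] {e : OpenPartialHomeomorph M E}
    (he : e ∈ IsManifold.maximalAtlas 𝓘(ℝ, E) ∞ M) (u : E) :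
    ContMDiffOn 𝓘(ℝ, E) (𝓘(ℝ, E).prod 𝓘(ℝ, E)) ∞
      (fun y => (⟨e.symm y, mfderiv 𝓘(ℝ, E) 𝓘(ℝ, E) e.symm y u⟩ : TangentBundle 𝓘(ℝ, E) M))
      e.target := by
  have h1 := (contMDiffOn_symm_of_mem_maximalAtlas he).contMDiffOn_tangentMapWithin
    (m := ∞) (by simp) e.open_target.uniqueMDiffOn
  have h2 : ContMDiff 𝓘(ℝ, E) (𝓘(ℝ, E).prod 𝓘(ℝ, E)) ∞
      (fun y => (⟨y, u⟩ : TangentBundle 𝓘(ℝ, E) E)) :=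
    contMDiff_vectorSpace_iff_contDiff.2 contDiff_const
  refine (h1.comp h2.contMDiffOn (s := e.target) fun y hy => hy).congr fun y hy => ?_
  simp only [Function.comp_apply, tangentMapWithin,
    mfderivWithin_of_isOpen e.open_target hy]

lemma mfderiv_symm_injective_of_mem_maximalAtlas [IsManifold 𝓘(ℝ, E) ∞ M]
    {e : OpenPartialHomeomorph M E}
    (he : e ∈ IsManifold.maximalAtlas 𝓘(ℝ, E) ∞ M) {y : E} (hy : y ∈ e.target) :
    Function.Injective (mfderiv 𝓘(ℝ, E) 𝓘(ℝ, E) e.symm y) := by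
  have hd : e.MDifferentiable 𝓘(ℝ, E) 𝓘(ℝ, E) :=
    ⟨(contMDiffOn_of_mem_maximalAtlas he).mdifferentiableOn (by simp),
      (contMDiffOn_symm_of_mem_maximalAtlas he).mdifferentiableOn (by simp)⟩
  exact hd.symm.mfderiv_injective hy

variable [RiemannianBundle (fun x : M => TangentSpace 𝓘(ℝ, E) x)]

lemma metricInChart_pos [IsManifold 𝓘(ℝ, E) ∞ M] {e : OpenPartialHomeomorph M E}
    (he : e ∈ IsManifold.maximalAtlas 𝓘(ℝ, E) ∞ M) {y : E} (hy : y ∈ e.target) (v : E)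
    (hv : v ≠ 0) : 0 < metricInChart e y v v := by
  have key (w : TangentSpace 𝓘(ℝ, E) (e.symm y)) (hw : w ≠ 0) : 0 < inner ℝ w w :=
    real_inner_self_pos.2 hw
  exact key _ fun h =>
    hv (mfderiv_symm_injective_of_mem_maximalAtlas he hy (h.trans (map_zero _).symm))

lemma contDiffOn_metricInChart [FiniteDimensional ℝ E] [IsManifold 𝓘(ℝ, E) ∞ M]
    [IsContMDiffRiemannianBundle 𝓘(ℝ, E) ∞ E (fun x : M => TangentSpace 𝓘(ℝ, E) x)]
    {e : OpenPartialHomeomorph M E} (he : e ∈ IsManifold.maximalAtlas 𝓘(ℝ, E) ∞ M) :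
    ContDiffOn ℝ ∞ (metricInChart e) e.target := by
  refine contDiffOn_clm_apply.2 fun u => contDiffOn_clm_apply.2 fun v => ?_
  rw [← contMDiffOn_iff_contDiffOn]
  exact ContMDiffOn.inner_bundle (F := E) (E := fun x : M => TangentSpace 𝓘(ℝ, E) x) (b := e.symm)
    (v := fun y => mfderiv 𝓘(ℝ, E) 𝓘(ℝ, E) e.symm y u)
    (w := fun y => mfderiv 𝓘(ℝ, E) 𝓘(ℝ, E) e.symm y v)
    (contMDiffOn_mfderiv_symm_apply he u) (contMDiffOn_mfderiv_symm_apply he v)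

/-- Two geodesics with the same position and velocity at some time agree near that time. -/
lemma IsGeodesicOn.eventuallyEq [FiniteDimensional ℝ E] [IsManifold 𝓘(ℝ, E) ∞ M]
    [IsContMDiffRiemannianBundle 𝓘(ℝ, E) ∞ E (fun x : M => TangentSpace 𝓘(ℝ, E) x)]
    {c₁ c₂ : ℝ → M} {J : Set ℝ} (hJ : IsOpen J) (h₁ : IsGeodesicOn E c₁ J)
    (h₂ : IsGeodesicOn E c₂ J) {t : ℝ} (ht : t ∈ J) {e : OpenPartialHomeomorph M E}
    (he : e ∈ IsManifold.maximalAtlas 𝓘(ℝ, E) ∞ M) (hte : c₁ t ∈ e.source)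
    (h0 : c₁ t = c₂ t) (h0' : deriv (e ∘ c₁) t = deriv (e ∘ c₂) t) :
    c₁ =ᶠ[𝓝 t] c₂ := by
  have hte₂ : c₂ t ∈ e.source := h0 ▸ hte
  have hsmooth {c : ℝ → M} (h : IsGeodesicOn E c J) (hc : c t ∈ e.source) :
      ContDiffAt ℝ ∞ (e ∘ c) t :=
    contMDiffAt_iff_contDiffAt.1 ((contMDiffAt_of_mem_maximalAtlas he hc).comp t
      (h.1.contMDiffAt (hJ.mem_nhds ht)))
  have hev {c : ℝ → M} (h : IsGeodesicOn E c J) (hc : c t ∈ e.source) :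
      ∀ᶠ s in 𝓝 t, c s ∈ e.source :=
    (h.1.continuousOn.continuousAt (hJ.mem_nhds ht)).preimage_mem_nhds (e.open_source.mem_nhds hc)
  have hode {c : ℝ → M} (h : IsGeodesicOn E c J) (hc : c t ∈ e.source) :
      ∀ᶠ s in 𝓝 t, deriv (deriv (e ∘ c)) s =
        (fun p : E × E => -christoffel (metricInChart e) p.1 p.2 p.2)
          ((e ∘ c) s, deriv (e ∘ c) s) := by
    filter_upwards [hev h hc, hJ.mem_nhds ht] with s hs hsJ
    exact eq_neg_of_add_eq_zero_left (h.2 s hsJ e he hs)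
  have htarget : e (c₁ t) ∈ e.target := e.map_source hte
  have hF := (contDiffAt_christoffel (v := deriv (e ∘ c₁) t)
    ((contDiffOn_metricInChart he).contDiffAt (e.open_target.mem_nhds htarget))
    (metricInChart_pos he htarget)).neg
  have := eventuallyEq_of_second_order_ode hF (hsmooth h₁ hte) (hsmooth h₂ hte₂) (hode h₁ hte)
    (hode h₂ hte₂) (by simp [h0]) h0'
  filter_upwards [this, hev h₁ hte, hev h₂ hte₂] with s hs hs₁ hs₂
  exact e.injOn hs₁ hs₂ hs

/-- Two geodesics with the same initial position and velocity agree on their common interval of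
definition: the set where they agree to first order is open by local uniqueness and closed by
continuity. -/
lemma IsGeodesicFrom.eq_one [FiniteDimensional ℝ E] [T2Space M] [IsManifold 𝓘(ℝ, E) ∞ M]
    [IsContMDiffRiemannianBundle 𝓘(ℝ, E) ∞ E (fun x : M => TangentSpace 𝓘(ℝ, E) x)]
    {p : M} {v : TangentSpace 𝓘(ℝ, E) p} {c₁ c₂ : ℝ → M}
    (h₁ : IsGeodesicFrom p v c₁) (h₂ : IsGeodesicFrom p v c₂) : c₁ 1 = c₂ 1 := by
  obtain ⟨⟨J₁, hJ₁, hJ₁c, hJ₁', hg₁⟩, hi₁⟩ := h₁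
  obtain ⟨⟨J₂, hJ₂, hJ₂c, hJ₂', hg₂⟩, hi₂⟩ := h₂
  set J := J₁ ∩ J₂
  have hJ : IsOpen J := hJ₁.inter hJ₂
  have hJc : IsPreconnected J := (hJ₁c.inter hJ₂c).isPreconnected
  have hJ1 : Icc 0 1 ⊆ J := subset_inter hJ₁' hJ₂'
  have h0J : (0 : ℝ) ∈ J := hJ1 (by simp)
  replace hg₁ : IsGeodesicOn E c₁ J :=
    ⟨hg₁.1.mono inter_subset_left, fun t ht => hg₁.2 t ht.1⟩
  replace hg₂ : IsGeodesicOn E c₂ J :=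
    ⟨hg₂.1.mono inter_subset_right, fun t ht => hg₂.2 t ht.2⟩
  set A : Set ℝ := {t | c₁ =ᶠ[𝓝 t] c₂}
  have hA : IsOpen A := isOpen_iff_eventually.2 fun t ht => ht.eventuallyEq_nhds
  have h0A : (0 : ℝ) ∈ A := by
    have hchart := mem_chart_source E (c₁ 0)
    have he := IsManifold.chart_mem_maximalAtlas (I := 𝓘(ℝ, E)) (n := ∞) (c₁ 0)
    have h0 : c₁ 0 = c₂ 0 := congrArg TotalSpace.proj (hi₁.trans hi₂.symm)
    refine hg₁.eventuallyEq hJ hg₂ h0J he hchart h0 ?_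
    have key {c : ℝ → M} (hg : IsGeodesicOn E c J) (hc : c 0 ∈ (chartAt E (c₁ 0)).source)
        (hi : (⟨c 0, mfderiv 𝓘(ℝ, ℝ) 𝓘(ℝ, E) c 0 (1 : ℝ)⟩ : TangentBundle 𝓘(ℝ, E) M) = ⟨p, v⟩) :
        deriv (chartAt E (c₁ 0) ∘ c) 0 =
          (tangentMap 𝓘(ℝ, E) 𝓘(ℝ, E) (chartAt E (c₁ 0)) ⟨p, v⟩).2 := by
      rw [← hi]
      have := mfderiv_comp (0 : ℝ)
        ((contMDiffAt_of_mem_maximalAtlas he hc).mdifferentiableAt (by simp))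
        ((hg.1.contMDiffAt (hJ.mem_nhds h0J)).mdifferentiableAt (by simp))
      rw [mfderiv_eq_fderiv] at this
      exact congrArg (fun L : ℝ →L[ℝ] E => L 1) this
    rw [key hg₁ hchart hi₁, key hg₂ (h0 ▸ hchart) hi₂]
  have hclosed : closure A ∩ J ⊆ A := by
    rintro t ⟨htA, htJ⟩
    have hfreq : ∃ᶠ s in 𝓝 t, c₁ =ᶠ[𝓝 s] c₂ := mem_closure_iff_frequently.1 htA
    have h0 : c₁ t = c₂ t := tendsto_nhds_unique_of_frequently_eq
      (hg₁.1.continuousOn.continuousAt (hJ.mem_nhds htJ))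
      (hg₂.1.continuousOn.continuousAt (hJ.mem_nhds htJ)) (hfreq.mono fun s hs => hs.eq_of_nhds)
    have hchart := mem_chart_source E (c₁ t)
    have he := IsManifold.chart_mem_maximalAtlas (I := 𝓘(ℝ, E)) (n := ∞) (c₁ t)
    refine hg₁.eventuallyEq hJ hg₂ htJ he hchart h0 ?_
    have hcont {c : ℝ → M} (hg : IsGeodesicOn E c J) (hc : c t ∈ (chartAt E (c₁ t)).source) :
        ContinuousAt (deriv (chartAt E (c₁ t) ∘ c)) t := by
      have h : ContDiffAt ℝ ∞ (chartAt E (c₁ t) ∘ c) t :=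
        contMDiffAt_iff_contDiffAt.1 ((contMDiffAt_of_mem_maximalAtlas he hc).comp t
          (hg.1.contMDiffAt (hJ.mem_nhds htJ)))
      exact ((h.fderiv_right (m := 0) (by simp)).clm_apply
        (contDiffAt_const (c := (1 : ℝ)))).continuousAt
    refine tendsto_nhds_unique_of_frequently_eq (hcont hg₁ hchart) (hcont hg₂ (h0 ▸ hchart))
      (hfreq.mono fun s hs => ?_)
    exact (hs.fun_comp (chartAt E (c₁ t))).deriv_eq
  have hsub := hJc.subset_of_closure_inter_subset hA ⟨0, h0J, h0A⟩ hclosed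
  exact (hsub (hJ1 (by simp))).eq_of_nhds

lemma IsGeodesicFrom.riemannianExp_eq [FiniteDimensional ℝ E] [T2Space M]
    [IsManifold 𝓘(ℝ, E) ∞ M]
    [IsContMDiffRiemannianBundle 𝓘(ℝ, E) ∞ E (fun x : M => TangentSpace 𝓘(ℝ, E) x)]
    {p : M} {v : TangentSpace 𝓘(ℝ, E) p} {c : ℝ → M} (h : IsGeodesicFrom p v c) :
    riemannianExp p v = c 1 := by
  have hex : ∃ c : ℝ → M, IsGeodesicFrom p v c := ⟨c, h⟩
  rw [riemannianExp, dif_pos hex]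
  exact hex.choose_spec.eq_one h

/-- If `exp_p v` is defined, some geodesic realizes it. No uniqueness of geodesics is needed. -/
lemma exists_isGeodesicFrom_eq_riemannianExp {p : M} {v : TangentSpace 𝓘(ℝ, E) p}
    (h : ∃ c : ℝ → M, IsGeodesicFrom p v c) :
    ∃ c : ℝ → M, IsGeodesicFrom p v c ∧ c 1 = riemannianExp p v :=
  ⟨h.choose, h.choose_spec, by rw [riemannianExp, dif_pos h]⟩

lemma isGeodesicFrom_const (p : M) : IsGeodesicFrom p (0 : TangentSpace 𝓘(ℝ, E) p) fun _ => p := by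
  refine ⟨⟨univ, isOpen_univ, ordConnected_univ, subset_univ _, contMDiffOn_const,
    fun t _ e _ _ => ?_⟩, ?_⟩
  · have h : e ∘ (fun _ : ℝ => p) = fun _ => e p := rfl
    simp [h, christoffel, christoffelForm]
  · rw [mfderiv_const]
    rfl

/-- A local isometry `f` intertwines the exponential maps, `exp (df v) = f (exp v)`. -/
lemma IsRiemannianLocalIsometry.riemannianExp_mfderiv [FiniteDimensional ℝ E]
    [IsManifold 𝓘(ℝ, E) ∞ M]
    {N : Type*} [TopologicalSpace N] [ChartedSpace E N] [T2Space N] [IsManifold 𝓘(ℝ, E) ∞ N]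
    [RiemannianBundle (fun x : N => TangentSpace 𝓘(ℝ, E) x)]
    [IsContMDiffRiemannianBundle 𝓘(ℝ, E) ∞ E (fun x : N => TangentSpace 𝓘(ℝ, E) x)]
    {f : M → N} (hf : IsRiemannianLocalIsometry E f)
    {p : M} {v : TangentSpace 𝓘(ℝ, E) p} (h : ∃ c : ℝ → M, IsGeodesicFrom p v c) :
    riemannianExp (f p) (mfderiv 𝓘(ℝ, E) 𝓘(ℝ, E) f p v) = f (riemannianExp p v) := by
  obtain ⟨c, hc, hc1⟩ := exists_isGeodesicFrom_eq_riemannianExp h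
  rw [← hc1]
  exact (hf.isGeodesicFrom_comp hc).riemannianExp_eq

end GeodesicUniqueness

/-! ### Local isometries and the Riemannian distance -/

section Distance

open Filter

variable {E : Type*} [NormedAddCommGroup E] [NormedSpace ℝ E]
  {M : Type*} [TopologicalSpace M] [ChartedSpace E M]
  [RiemannianBundle (fun x : M => TangentSpace 𝓘(ℝ, E) x)]
  {N : Type*} [TopologicalSpace N] [ChartedSpace E N]
  [RiemannianBundle (fun x : N => TangentSpace 𝓘(ℝ, E) x)]
  {f : M → N}

lemma IsRiemannianLocalIsometry.pathELength_comp (hf : IsRiemannianLocalIsometry E f)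
    {γ : ℝ → M} {a b : ℝ} (hγ : ContMDiffOn 𝓘(ℝ, ℝ) 𝓘(ℝ, E) 1 γ (Icc a b)) :
    pathELength 𝓘(ℝ, E) (f ∘ γ) a b = pathELength 𝓘(ℝ, E) γ a b := by
  simp only [pathELength_eq_lintegral_mfderiv_Ioo]
  refine MeasureTheory.setLIntegral_congr_fun measurableSet_Ioo fun t ht => ?_
  have hd : MDifferentiableAt 𝓘(ℝ, ℝ) 𝓘(ℝ, E) γ t :=
    (hγ.contMDiffAt (Icc_mem_nhds ht.1 ht.2)).mdifferentiableAt (by simp)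
  simp only [mfderiv_comp t (hf.mdifferentiableAt _) hd]
  exact congrArg ENNReal.ofNNReal
    (NNReal.eq (hf.norm_mfderiv (γ t) (mfderiv 𝓘(ℝ, ℝ) 𝓘(ℝ, E) γ t 1)))

/-- Local isometries do not increase distances. -/
lemma IsRiemannianLocalIsometry.riemannianEDist_map_le (hf : IsRiemannianLocalIsometry E f)
    (x y : M) : riemannianEDist 𝓘(ℝ, E) (f x) (f y) ≤ riemannianEDist 𝓘(ℝ, E) x y := by
  refine le_of_forall_gt fun r hr => ?_
  obtain ⟨γ, h0, h1, hγ, hlen⟩ := exists_lt_of_riemannianEDist_lt hr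
  refine (riemannianEDist_le_pathELength
    ((hf.contMDiff.of_le (by simp)).comp_contMDiffOn hγ) (by simp [h0]) (by simp [h1])
    zero_le_one).trans_lt ?_
  rwa [hf.pathELength_comp hγ]

/-- A Riemannian covering maps the ball around `x` onto the ball of the same radius around `f x`:
short paths lift to paths of the same length. -/
lemma IsRiemannianCovering.exists_riemannianEDist_lt (hf : IsRiemannianCovering E f)
    {x : M} {q : N} {r : ℝ≥0∞} (hr : riemannianEDist 𝓘(ℝ, E) (f x) q < r) :
    ∃ y, f y = q ∧ riemannianEDist 𝓘(ℝ, E) x y < r := by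
  obtain ⟨γ, h0, h1, hγ, hlen, -, -⟩ :=
    exists_lt_locally_constant_of_riemannianEDist_lt hr zero_lt_one
  let γI : C(unitInterval, N) := ⟨fun t => γ t, hγ.continuous.comp continuous_subtype_val⟩
  have hγ0 : γI 0 = f x := by simpa [γI] using h0
  let Γ := hf.isCoveringMap.liftPath γI x hγ0
  have hΓ (t) : f (Γ t) = γ t := congrFun (hf.isCoveringMap.liftPath_lifts γI x hγ0) t
  let c : ℝ → M := IccExtend zero_le_one Γ
  have hc : Continuous c := Γ.continuous.Icc_extend'
  have hfc : EqOn (f ∘ c) γ (Icc 0 1) := fun t ht => by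
    simp only [c, Function.comp_apply, IccExtend_of_mem zero_le_one Γ ht, hΓ]
  have hcs : ContMDiffOn 𝓘(ℝ, ℝ) 𝓘(ℝ, E) 1 c (Icc 0 1) := by
    intro t ht
    obtain ⟨Φ, htΦ, hΦ⟩ := hf.isLocalDiffeomorph (c t)
    have hγt : γ t ∈ Φ.target := by
      rw [← hfc ht, Function.comp_apply, hΦ htΦ]
      exact Φ.map_source htΦ
    have hsm : ContMDiffAt 𝓘(ℝ, ℝ) 𝓘(ℝ, E) 1 (Φ.symm ∘ γ) t :=
      ((Φ.contMDiffOn_invFun.contMDiffAt (Φ.open_target.mem_nhds hγt)).of_le (by simp)).comp t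
        (hγ t)
    have hinv {s : ℝ} (hs : s ∈ Icc (0 : ℝ) 1) (hsΦ : c s ∈ Φ.source) :
        c s = (Φ.symm ∘ γ) s := by
      rw [Function.comp_apply, ← hfc hs, Function.comp_apply, hΦ hsΦ]
      exact (Φ.left_inv hsΦ).symm
    refine hsm.contMDiffWithinAt.congr_of_eventuallyEq ?_ (hinv ht htΦ)
    filter_upwards [self_mem_nhdsWithin, nhdsWithin_le_nhds
      (hc.continuousAt.preimage_mem_nhds (Φ.open_source.mem_nhds htΦ))] with s hs hsΦ
    exact hinv hs hsΦ
  have hc0 : c 0 = x := by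
    simp only [c, IccExtend_left]
    exact hf.isCoveringMap.liftPath_zero γI x hγ0
  refine ⟨c 1, by rw [← h1]; exact hfc (by simp), ?_⟩
  refine (riemannianEDist_le_pathELength hcs hc0 rfl zero_le_one).trans_lt ?_
  rwa [← hf.isRiemannianLocalIsometry.pathELength_comp hcs, pathELength_congr hfc]

end Distance

/-! ### The exponential map and Riemannian coverings -/

section ExpTransfer

variable {E : Type*} [NormedAddCommGroup E] [NormedSpace ℝ E]
  {M : Type*} [TopologicalSpace M] [ChartedSpace E M]
  [RiemannianBundle (fun x : M => TangentSpace 𝓘(ℝ, E) x)]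
  {N : Type*} [TopologicalSpace N] [ChartedSpace E N]
  [RiemannianBundle (fun x : N => TangentSpace 𝓘(ℝ, E) x)]
  {f : M → N}

lemma ExpIsDiffeoOnBall.of_lt_injectivityRadius {p : M} {r : ℝ} (hr : 0 < r)
    (h : ENNReal.ofReal r < injectivityRadius E p) : ExpIsDiffeoOnBall E p r := by
  obtain ⟨R, hR, hrR⟩ := lt_sSup_iff.1 h
  exact hR r hr hrR

/-- If a Riemannian covering is injective on a ball on which the exponential map is a
diffeomorphism, the exponential map at the image point is a diffeomorphism on the ball of the same
radius. -/
lemma IsRiemannianCovering.expIsDiffeoOnBall [FiniteDimensional ℝ E] [IsManifold 𝓘(ℝ, E) ∞ M]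
    [T2Space N] [IsManifold 𝓘(ℝ, E) ∞ N]
    [IsContMDiffRiemannianBundle 𝓘(ℝ, E) ∞ E (fun x : N => TangentSpace 𝓘(ℝ, E) x)]
    (hf : IsRiemannianCovering E f) {p : M} {r : ℝ} (h : ExpIsDiffeoOnBall E p r)
    (hinj : InjOn f {q : M | riemannianEDist 𝓘(ℝ, E) p q < ENNReal.ofReal r}) :
    ExpIsDiffeoOnBall E (f p) r := by
  have hloc := hf.isRiemannianLocalIsometry
  obtain ⟨hgeo, Φ, hsource, htarget, hΦ⟩ := h
  have : Nonempty M := ⟨p⟩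
  obtain ⟨Ψ, hΨs, -, hΨ⟩ := hf.isLocalDiffeomorph.exists_partialDiffeomorph_of_injOn
    (htarget ▸ Φ.open_target) hinj
  let L : TangentSpace 𝓘(ℝ, E) p ≃L[ℝ] TangentSpace 𝓘(ℝ, E) (f p) :=
    (hf.isLocalDiffeomorph p).mfderivToContinuousLinearEquiv (by simp)
  have hL (w) : L w = mfderiv 𝓘(ℝ, E) 𝓘(ℝ, E) f p w := rfl
  have hLnorm (v : TangentSpace 𝓘(ℝ, E) (f p)) : ‖L.symm v‖ = ‖v‖ := by
    rw [← hloc.norm_mfderiv p (L.symm v), ← hL, L.apply_symm_apply]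
  refine ⟨fun v hv => ?_, ?_⟩
  · obtain ⟨c, hc⟩ := hgeo (L.symm v) (by rwa [hLnorm])
    refine ⟨f ∘ c, ?_⟩
    have := hloc.isGeodesicFrom_comp hc
    rwa [← hL, L.apply_symm_apply] at this
  let L' : E ≃L[ℝ] E := L
  let Θ := (L'.symm.toDiffeomorph.toPartialDiffeomorph (n := ∞)).trans (Φ.trans Ψ)
  have hΘ (v : E) : Θ v = f (Φ (L'.symm v)) := by
    change Ψ (Φ (L'.symm v)) = _
    rw [hΨ]
  have hΘs : Θ.source = {v : TangentSpace 𝓘(ℝ, E) (f p) | ‖v‖ < r} := by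
    ext v
    have h1 : L'.symm v ∈ Φ.source ↔ v ∈ {v : TangentSpace 𝓘(ℝ, E) (f p) | ‖v‖ < r} := by
      rw [hsource]
      exact ⟨fun h => (hLnorm v).symm.trans_lt h, fun h => (hLnorm v).trans_lt h⟩
    refine ⟨fun hv => h1.1 hv.2.1, fun hv => ⟨mem_univ _, h1.2 hv, ?_⟩⟩
    have := Φ.map_source (h1.2 hv)
    rw [htarget, ← hΨs] at this
    exact this
  refine ⟨Θ, hΘs, ?_, fun v hv => ?_⟩
  · rw [← Θ.image_source_eq_target, hΘs]
    ext q
    constructor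
    · rintro ⟨v, hv, rfl⟩
      have hv' : L'.symm v ∈ Φ.source := by
        rw [hsource]
        exact (hLnorm v).trans_lt hv
      have := Φ.map_source hv'
      rw [htarget] at this
      exact (congrArg _ (hΘ v)).trans_lt ((hloc.riemannianEDist_map_le _ _).trans_lt this)
    · intro hq
      obtain ⟨y, rfl, hy⟩ := hf.exists_riemannianEDist_lt hq
      have hy' : y ∈ Φ.target := by rw [htarget]; exact hy
      refine ⟨L' (Φ.symm y), ?_, ?_⟩
      · have := Φ.map_target hy'
        rw [hsource] at this
        exact (hloc.norm_mfderiv p (Φ.symm y)).trans_lt this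
      · refine (hΘ _).trans (congrArg f ?_)
        rw [L'.symm_apply_apply]
        exact Φ.right_inv hy'
  · have hv' : ‖L.symm v‖ < r := by rwa [hLnorm]
    have := hloc.riemannianExp_mfderiv (hgeo _ hv')
    rw [← hL, L.apply_symm_apply] at this
    rw [this, ← hΦ _ hv']
    exact hΘ v

end ExpTransfer

/-! ### The smooth structure of the quotient -/

section QuotientManifold

open Filter

variable {E : Type*} [NormedAddCommGroup E] {M : Type*} [TopologicalSpace M] [ChartedSpace E M]
  {N : Type*} [TopologicalSpace N] {Γ : Type*} [Group Γ] [MulAction Γ M] {f : M → N}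

/-- The chart of the base of a quotient covering `f` at `f a`: a local section of `f`
followed by a chart at `a`. -/
noncomputable def IsLocalHomeomorph.quotientChart (E : Type*) [TopologicalSpace E]
    {M N : Type*} [TopologicalSpace M] [ChartedSpace E M] [TopologicalSpace N] {f : M → N}
    (hf : IsLocalHomeomorph f) (a : M) : OpenPartialHomeomorph N E :=
  (hf.localInverseAt a).trans (chartAt E a)

/-- Near any point `x` over the domain of a quotient chart, the chart composed with the projection
is a chart of `M` composed with an element of the group. -/
lemma IsQuotientCoveringMap.exists_smul_quotientChart (hf : IsQuotientCoveringMap f Γ)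
    (hl : IsLocalHomeomorph f) {a x : M} (hx : f x ∈ (hl.quotientChart E a).source) :
    ∃ γ : Γ, γ • x ∈ (chartAt E a).source ∧
      (∀ᶠ y in 𝓝 x, hl.quotientChart E a (f y) = chartAt E a (γ • y)) ∧
      γ⁻¹ • (chartAt E a).symm (hl.quotientChart E a (f x)) = x ∧
      ∀ z, f (γ⁻¹ • (chartAt E a).symm z) = (hl.quotientChart E a).symm z := by
  have hx1 : f x ∈ (hl.localInverseAt a).source := hx.1
  have hx2 : hl.localInverseAt a (f x) ∈ (chartAt E a).source := hx.2
  obtain ⟨γ, hγ⟩ := hf.apply_eq_iff_mem_orbit.1 (hl.apply_localInverseAt_of_mem hx1)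
  replace hγ : γ • x = hl.localInverseAt a (f x) := hγ
  have := hf.toContinuousConstSMul
  have key {y : M} (hy : γ • y ∈ (hl.localInverseAt a).target) :
      hl.localInverseAt a (f y) = γ • y := by
    rw [← hf.map_smul γ (e := y), ← congrFun (hl.localInverseAt_symm a) (γ • y)]
    exact (hl.localInverseAt a).right_inv hy
  have hmem : γ • x ∈ (hl.localInverseAt a).target := by
    rw [hγ]
    exact (hl.localInverseAt a).map_source hx1
  refine ⟨γ, hγ ▸ hx2, ?_, ?_, fun z => ?_⟩
  · filter_upwards [(continuous_const_smul γ).continuousAt.preimage_mem_nhds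
      ((hl.localInverseAt a).open_target.mem_nhds hmem)] with y hy
    exact congrArg (chartAt E a) (key hy)
  · change γ⁻¹ • (chartAt E a).symm (chartAt E a (hl.localInverseAt a (f x))) = x
    rw [(chartAt E a).left_inv hx2, ← hγ, inv_smul_smul]
  · rw [hf.map_smul, ← congrFun (hl.localInverseAt_symm a)]
    rfl

/-- The base of a quotient covering of a manifold by a group of diffeomorphisms is a manifold, and
the projection is a local diffeomorphism. -/
lemma IsQuotientCoveringMap.exists_isManifold [NormedSpace ℝ E]
    [IsManifold 𝓘(ℝ, E) ∞ M] (hf : IsQuotientCoveringMap f Γ)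
    (hΓ : ∀ γ : Γ, ContMDiff 𝓘(ℝ, E) 𝓘(ℝ, E) ∞ (fun x : M => γ • x)) :
    ∃ (_ : ChartedSpace E N) (_ : IsManifold 𝓘(ℝ, E) ∞ N),
      IsLocalDiffeomorph 𝓘(ℝ, E) 𝓘(ℝ, E) ∞ f := by
  have hl := hf.isCoveringMap.isLocalHomeomorph
  let _ : ChartedSpace E N := hl.chartedSpace hf.surjective
  have hatlas {e : OpenPartialHomeomorph N E} (he : e ∈ atlas E N) :
      ∃ a, e = hl.quotientChart E a := by
    obtain ⟨q, rfl⟩ := he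
    exact ⟨_, rfl⟩
  -- The composition of a chart with the projection is smooth.
  have hcomp {e : OpenPartialHomeomorph N E} (he : e ∈ atlas E N) {x : M} (hx : f x ∈ e.source) :
      ContMDiffAt 𝓘(ℝ, E) 𝓘(ℝ, E) ∞ (e ∘ f) x := by
    obtain ⟨a, rfl⟩ := hatlas he
    obtain ⟨γ, hγ, hev, -⟩ := hf.exists_smul_quotientChart hl hx
    refine ContMDiffAt.congr_of_eventuallyEq ?_ hev
    exact (contMDiffAt_of_mem_maximalAtlas (IsManifold.chart_mem_maximalAtlas a) hγ).comp x
      (hΓ γ x)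
  -- The inverse of a chart lifts to a smooth map to the total space.
  have hlift {e : OpenPartialHomeomorph N E} (he : e ∈ atlas E N) {x : M} (hx : f x ∈ e.source) :
      ∃ σ : E → M, ContMDiffAt 𝓘(ℝ, E) 𝓘(ℝ, E) ∞ σ (e (f x)) ∧ σ (e (f x)) = x ∧
        ∀ z, f (σ z) = e.symm z := by
    obtain ⟨a, rfl⟩ := hatlas he
    obtain ⟨γ, hγ, hev, hinv, hsec⟩ := hf.exists_smul_quotientChart hl hx
    refine ⟨fun z => γ⁻¹ • (chartAt E a).symm z, ?_, hinv, hsec⟩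
    refine (hΓ γ⁻¹ _).comp _ (contMDiffAt_symm_of_mem_maximalAtlas
      (IsManifold.chart_mem_maximalAtlas a) ?_)
    rw [hev.self_of_nhds]
    exact (chartAt E a).map_source hγ
  have hman : IsManifold 𝓘(ℝ, E) ∞ N := by
    refine isManifold_of_contDiffOn _ _ _ fun e e' he he' z hz => ?_
    have hz1 : z ∈ e.target := hz.1.1
    have hz2 : e.symm z ∈ e'.source := hz.1.2
    obtain ⟨x, hx⟩ := hf.surjective (e.symm z)
    have hxe : f x ∈ e.source := hx ▸ e.map_target hz1
    obtain ⟨σ, hσ, hσx, hsec⟩ := hlift he hxe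
    have hzx : e (f x) = z := by rw [hx, e.right_inv hz1]
    rw [hzx] at hσ hσx
    have := (hcomp he' (hx ▸ hz2)).comp_of_eq hσ hσx
    refine (contMDiffAt_iff_contDiffAt.1 this).contDiffWithinAt.congr (fun w _ => ?_) ?_ <;>
    simp [hsec]
  refine ⟨inferInstance, hman, fun x => ?_⟩
  have hchart (q : N) : chartAt E q ∈ IsManifold.maximalAtlas 𝓘(ℝ, E) ∞ N :=
    IsManifold.chart_mem_maximalAtlas q
  let P := (hl.localInverseAt x).symm
  have hP : ⇑P = f := hl.localInverseAt_symm x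
  refine ⟨⟨P.toPartialEquiv, P.open_source, P.open_target, fun y hy => ?_, fun q hq => ?_⟩,
    hl.self_mem_localInverseAt_target, fun y _ => congrFun hP.symm y⟩
  · have hy' := mem_chart_source E (f y)
    have h1 : ContMDiffAt 𝓘(ℝ, E) 𝓘(ℝ, E) ∞ ((chartAt E (f y)).symm ∘ (chartAt E (f y) ∘ f)) y :=
      (contMDiffAt_symm_of_mem_maximalAtlas (hchart (f y))
        ((chartAt E (f y)).map_source hy')).comp y (hcomp (chart_mem_atlas E (f y)) hy')
    refine (h1.congr_of_eventuallyEq ?_).contMDiffWithinAt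
    filter_upwards [hl.continuous.continuousAt.preimage_mem_nhds
      ((chartAt E (f y)).open_source.mem_nhds hy')] with w hw
    exact (congrFun hP w).trans ((chartAt E (f y)).left_inv hw).symm
  · have hq' := mem_chart_source E q
    have hfq : f (P.symm q) = q := by rw [← hP]; exact P.right_inv hq
    obtain ⟨σ, hσ, hσx, hsec⟩ := hlift (chart_mem_atlas E q) (x := P.symm q) (by rwa [hfq])
    rw [hfq] at hσ hσx
    have h1 : ContMDiffAt 𝓘(ℝ, E) 𝓘(ℝ, E) ∞ (σ ∘ chartAt E q) q :=
      hσ.comp q (contMDiffAt_of_mem_maximalAtlas (hchart q) hq')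
    refine (h1.congr_of_eventuallyEq ?_).contMDiffWithinAt
    filter_upwards [h1.continuousAt.preimage_mem_nhds (P.open_source.mem_nhds
      (by rw [Function.comp_apply, hσx]; exact P.map_target hq)),
      (chartAt E q).open_source.mem_nhds hq'] with n hn hn'
    have h2 : f (σ (chartAt E q n)) = n := by rw [hsec, (chartAt E q).left_inv hn']
    have h3 := P.left_inv hn
    rw [hP, Function.comp_apply, h2] at h3
    exact h3

end QuotientManifold

/-! ### The Riemannian metric of the quotient -/

section QuotientMetric

open Filter

variable {E : Type*} [NormedAddCommGroup E] [NormedSpace ℝ E]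
  {M : Type*} [TopologicalSpace M] [ChartedSpace E M]
  [RiemannianBundle (fun x : M => TangentSpace 𝓘(ℝ, E) x)]
  {N : Type*} [TopologicalSpace N] [ChartedSpace E N] {f : M → N}

/-- A Riemannian metric is smooth if its coefficients in the preferred charts are. -/
lemma isContMDiffRiemannianBundle_of_metricInChart [IsManifold 𝓘(ℝ, E) ∞ M]
    (h : ∀ p : M, ContDiffAt ℝ ∞ (metricInChart (chartAt E p)) (chartAt E p p)) :
    IsContMDiffRiemannianBundle 𝓘(ℝ, E) ∞ E (fun x : M => TangentSpace 𝓘(ℝ, E) x) := by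
  refine ⟨fun x => innerSL ℝ, fun p => ?_, fun x v w => rfl⟩
  rw [contMDiffAt_hom_bundle]
  refine ⟨contMDiffAt_id, ?_⟩
  have hp := mem_chart_source E p
  have hsm : ContMDiffAt 𝓘(ℝ, E) 𝓘(ℝ, E →L[ℝ] E →L[ℝ] ℝ) ∞
      (metricInChart (chartAt E p) ∘ chartAt E p) p :=
    (contMDiffAt_iff_contDiffAt.2 (h p)).comp p (contMDiffAt_of_mem_maximalAtlas
      (IsManifold.chart_mem_maximalAtlas p) hp)
  refine hsm.congr_of_eventuallyEq ?_
  filter_upwards [(chartAt E p).open_source.mem_nhds hp] with q hq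
  ext u v
  have hq' : q ∈ (trivializationAt E (TangentSpace 𝓘(ℝ, E)) p).baseSet := hq
  have key (w : E) : (trivializationAt E (TangentSpace 𝓘(ℝ, E)) p).symm q w =
      mfderiv 𝓘(ℝ, E) 𝓘(ℝ, E) (chartAt E p).symm (chartAt E p q) w := by
    have := TangentBundle.symmL_trivializationAt (𝕜 := ℝ) (I := 𝓘(ℝ, E)) hq
    simp only [mfld_simps, mfderivWithin_univ] at this
    rw [← (trivializationAt E (TangentSpace 𝓘(ℝ, E)) p).symmL_apply (R := ℝ) hq']
    exact congrArg (fun T : E →L[ℝ] E => T w) this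
  simp only [Function.comp_apply]
  rw [inCoordinates_apply_eq₂ hq' hq' (mem_univ _), metricInChart_apply]
  let I (q' : M) : E →L[ℝ] E →L[ℝ] ℝ := innerSL ℝ (E := TangentSpace 𝓘(ℝ, E) q')
  refine Eq.trans ?_ (congrArg (fun q' => I q' _ _) ((chartAt E p).left_inv hq).symm)
  rw [← key, ← key]
  exact LinearMap.congr_fun (Trivial.linearMapAt_trivialization ℝ M ℝ q) _

/-- The target of a surjective local isometry inherits the smoothness of the metric. -/
lemma IsRiemannianLocalIsometry.isContMDiffRiemannianBundle [FiniteDimensional ℝ E]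
    [IsManifold 𝓘(ℝ, E) ∞ M]
    [IsContMDiffRiemannianBundle 𝓘(ℝ, E) ∞ E (fun x : M => TangentSpace 𝓘(ℝ, E) x)]
    [IsManifold 𝓘(ℝ, E) ∞ N] [RiemannianBundle (fun x : N => TangentSpace 𝓘(ℝ, E) x)]
    (hf : IsRiemannianLocalIsometry E f) (hsurj : Function.Surjective f) :
    IsContMDiffRiemannianBundle 𝓘(ℝ, E) ∞ E (fun x : N => TangentSpace 𝓘(ℝ, E) x) := by
  refine isContMDiffRiemannianBundle_of_metricInChart fun q => ?_
  obtain ⟨p, rfl⟩ := hsurj q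
  obtain ⟨e', he', hpe', hval, -, hsymm⟩ := hf.isLocalDiffeomorph.exists_pullback_chart
    (IsManifold.chart_mem_maximalAtlas (f p)) (mem_chart_source E (f p))
  have hmem : chartAt E (f p) (f p) ∈ e'.target := hval p hpe' ▸ e'.map_source hpe'
  have hnhds := e'.open_target.mem_nhds hmem
  exact ((contDiffOn_metricInChart he').contDiffAt hnhds).congr_of_eventuallyEq
    ((hf.metricInChart_eqOn he' hsymm).symm.eventuallyEq_of_mem hnhds)

/-- The Riemannian metric descends along a surjective local diffeomorphism `f` if the fibers of `f`
are related by isometries of the source. -/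
lemma IsLocalDiffeomorph.exists_riemannianBundle
    (hf : IsLocalDiffeomorph 𝓘(ℝ, E) 𝓘(ℝ, E) ∞ f) (hsurj : Function.Surjective f)
    (hdeck : ∀ x y, f x = f y → ∃ φ : M → M, MDifferentiableAt 𝓘(ℝ, E) 𝓘(ℝ, E) φ x ∧
      (∀ v w : TangentSpace 𝓘(ℝ, E) x, inner ℝ (mfderiv 𝓘(ℝ, E) 𝓘(ℝ, E) φ x v)
        (mfderiv 𝓘(ℝ, E) 𝓘(ℝ, E) φ x w) = inner ℝ v w) ∧ φ x = y ∧ f ∘ φ = f) :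
    ∃ _ : RiemannianBundle (fun q : N => TangentSpace 𝓘(ℝ, E) q),
      IsRiemannianLocalIsometry E f := by
  let s : N → M := Function.surjInv hsurj
  have hs (q : N) : f (s q) = q := Function.surjInv_eq hsurj q
  -- All tangent spaces are copies of `E`, so that the differential of `f` at a preimage of `q` is
  -- an automorphism of `E`, whose inverse is a map from the tangent space at `q`.
  let L (x : M) : E ≃L[ℝ] E := (hf x).mfderivToContinuousLinearEquiv (by simp)
  let B (x : M) : E →L[ℝ] E →L[ℝ] ℝ :=
    (RiemannianBundle.g (E := fun x : M => TangentSpace 𝓘(ℝ, E) x)).inner x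
  let g (q : N) : E →L[ℝ] E →L[ℝ] ℝ := (B (s q)).bilinearComp
    (L (s q)).symm.toContinuousLinearMap (L (s q)).symm.toContinuousLinearMap
  have hg (q : N) (v w : E) : g q v w = B (s q) ((L (s q)).symm v) ((L (s q)).symm w) := rfl
  have hsymm (q : N) (v w : E) : g q v w = g q w v :=
    (RiemannianBundle.g (E := fun x : M => TangentSpace 𝓘(ℝ, E) x)).symm (s q) _ _
  have hpos (q : N) (v : E) (hv : v ≠ 0) : 0 < g q v v :=
    (RiemannianBundle.g (E := fun x : M => TangentSpace 𝓘(ℝ, E) x)).pos (s q) _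
      fun h0 => hv ((L (s q)).symm.map_eq_zero_iff.1 h0)
  have hcont (q : N) : ContinuousAt (fun v : E => g q v v) 0 := by
    have : Continuous fun v : E => g q v v := by fun_prop
    exact this.continuousAt
  have hbdd (q : N) : Bornology.IsVonNBounded ℝ {v : E | g q v v < 1} := by
    have h1 : Bornology.IsVonNBounded ℝ {v : E | B (s q) v v < 1} :=
      (RiemannianBundle.g (E := fun x : M => TangentSpace 𝓘(ℝ, E) x)).isVonNBounded (s q)
    refine (h1.image (L (s q)).toContinuousLinearMap).subset ?_
    intro v hv
    exact ⟨(L (s q)).symm v, hv, (L (s q)).apply_symm_apply v⟩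
  let h : RiemannianMetric (fun q : N => TangentSpace 𝓘(ℝ, E) q) := ⟨g, hsymm, hpos, hcont, hbdd⟩
  let _ : RiemannianBundle (fun q : N => TangentSpace 𝓘(ℝ, E) q) := ⟨h⟩
  refine ⟨inferInstance, hf, fun x v w => ?_⟩
  obtain ⟨φ, hφ, hφi, hφx, hfφ⟩ := hdeck x (s (f x)) (hs (f x)).symm
  let D : E →L[ℝ] E := mfderiv 𝓘(ℝ, E) 𝓘(ℝ, E) φ x
  have hLφ (u : E) : L x u = L (φ x) (D u) := by
    have := mfderiv_comp x (hf.mdifferentiable (by simp) (φ x)) hφ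
    rw [hfφ] at this
    exact congrArg (fun T : E →L[ℝ] E => T u) this
  have key (v w : E) : g (f x) (L x v) (L x w) = B x v w := by
    rw [hg, ← hφx, hLφ, hLφ, (L (φ x)).symm_apply_apply, (L (φ x)).symm_apply_apply]
    exact hφi v w
  exact key v w

end QuotientMetric

/-! ### Isometric group actions and their quotients -/

section Action

/-- A free isometric action that moves no point by a positive distance less than a uniform `δ` is
properly discontinuous: given points `k` and `l`, at most one group element maps `k` to within
`δ / 2` of `l`, and finitely many such pairs serve for two compact sets. -/
lemma properlyDiscontinuousSMul_of_uniform {Γ X : Type*} [Group Γ] [EMetricSpace X]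
    [MulAction Γ X] (hfree : ∀ (γ : Γ) (p : X), γ • p = p → γ = 1)
    (hisom : ∀ (γ : Γ) (x y : X), edist (γ • x) (γ • y) ≤ edist x y) {δ : ℝ≥0∞} (hδ : 0 < δ)
    (h : ∀ (p : X) (γ : Γ), edist p (γ • p) < δ → p = γ • p) :
    ProperlyDiscontinuousSMul Γ X := by
  refine ⟨fun {K L} hK hL => ?_⟩
  have hε : 0 < δ / 4 := ENNReal.div_pos hδ.ne' (by simp)
  obtain ⟨s, -, hs⟩ := hK.elim_nhds_subcover (fun x => Metric.eball x (δ / 4))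
    fun x _ => Metric.eball_mem_nhds x hε
  obtain ⟨t, -, ht⟩ := hL.elim_nhds_subcover (fun x => Metric.eball x (δ / 4))
    fun x _ => Metric.eball_mem_nhds x hε
  have hhalf : δ / 4 + δ / 4 = δ / 2 := by
    rw [← ENNReal.add_div, ← two_mul, show (4 : ℝ≥0∞) = 2 * 2 by norm_num,
      ENNReal.mul_div_mul_left _ _ (by simp) (by simp)]
  have hsub (k l : X) : {γ : Γ | edist (γ • k) l < δ / 2}.Subsingleton := by
    intro γ hγ γ' hγ'
    have h1 : edist (γ • k) (γ' • k) < δ := by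
      calc edist (γ • k) (γ' • k) ≤ edist (γ • k) l + edist (γ' • k) l := edist_triangle_right _ _ _
        _ < δ / 2 + δ / 2 := ENNReal.add_lt_add hγ hγ'
        _ = δ := ENNReal.add_halves δ
    have h2 : edist k ((γ⁻¹ * γ') • k) < δ := by
      refine lt_of_le_of_lt ?_ h1
      simpa [mul_smul] using hisom γ⁻¹ (γ • k) (γ' • k)
    exact inv_mul_eq_one.1 (hfree _ _ (h k _ h2).symm)
  refine Set.Finite.subset (s := ⋃ k ∈ s, ⋃ l ∈ t, {γ : Γ | edist (γ • k) l < δ / 2})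
    (s.finite_toSet.biUnion fun k _ => t.finite_toSet.biUnion fun l _ => (hsub k l).finite) ?_
  rintro γ ⟨_, ⟨x, hx, rfl⟩, hxL⟩
  obtain ⟨k, hk, hxk⟩ := mem_iUnion₂.1 (hs hx)
  obtain ⟨l, hl, hxl⟩ := mem_iUnion₂.1 (ht hxL)
  refine mem_iUnion₂.2 ⟨k, hk, mem_iUnion₂.2 ⟨l, hl, ?_⟩⟩
  calc edist (γ • k) l ≤ edist (γ • k) (γ • x) + edist (γ • x) l := edist_triangle _ _ _
    _ < δ / 4 + δ / 4 :=
      ENNReal.add_lt_add ((hisom γ k x).trans_lt (by rwa [edist_comm])) hxl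
    _ = δ / 2 := hhalf

variable {E : Type*} [NormedAddCommGroup E] [NormedSpace ℝ E]
  {M : Type*} [EMetricSpace M] [ChartedSpace E M]
  [RiemannianBundle (fun x : M => TangentSpace 𝓘(ℝ, E) x)] {Γ : Type*} [Group Γ] [MulAction Γ M]

lemma ActsByIsometries.isRiemannianLocalIsometry (h : ActsByIsometries E Γ M) (γ : Γ) :
    IsRiemannianLocalIsometry E (fun x : M => γ • x) := by
  let φ : M ≃ₘ^∞⟮𝓘(ℝ, E), 𝓘(ℝ, E)⟯ M :=
    ⟨MulAction.toPerm γ, h.contMDiff_smul γ, h.contMDiff_smul γ⁻¹⟩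
  exact ⟨φ.isLocalDiffeomorph, h.inner_mfderiv_smul γ⟩

lemma ActsByIsometries.edist_smul_le [IsManifold 𝓘(ℝ, E) ∞ M] [IsRiemannianManifold 𝓘(ℝ, E) M]
    (h : ActsByIsometries E Γ M) (γ : Γ) (x y : M) : edist (γ • x) (γ • y) ≤ edist x y := by
  rw [IsRiemannianManifold.out (I := 𝓘(ℝ, E)) (γ • x) (γ • y),
    IsRiemannianManifold.out (I := 𝓘(ℝ, E)) x y]
  exact (h.isRiemannianLocalIsometry γ).riemannianEDist_map_le x y

/-- Bounded geometry passes to the base of a Riemannian covering that identifies no two points at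
distance less than a uniform constant `δ`. -/
lemma IsRiemannianCovering.hasBoundedGeometry [FiniteDimensional ℝ E] [IsManifold 𝓘(ℝ, E) ∞ M]
    [IsRiemannianManifold 𝓘(ℝ, E) M]
    {N : Type*} [TopologicalSpace N] [T2Space N] [ChartedSpace E N] [IsManifold 𝓘(ℝ, E) ∞ N]
    [RiemannianBundle (fun x : N => TangentSpace 𝓘(ℝ, E) x)]
    [IsContMDiffRiemannianBundle 𝓘(ℝ, E) ∞ E (fun x : N => TangentSpace 𝓘(ℝ, E) x)]
    {f : M → N} (hf : IsRiemannianCovering E f) (hsurj : Function.Surjective f)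
    (hM : HasBoundedGeometry E M) {δ : ℝ} (hδ : 0 < δ)
    (hinj : ∀ x y, f x = f y → edist x y ≤ ENNReal.ofReal δ → x = y) :
    HasBoundedGeometry E N := by
  refine fun k => ⟨fun i hi => ?_, ?_⟩
  · obtain ⟨V, hV⟩ := (hM k).1 i hi
    refine ⟨V, hsurj.forall.2 fun p => hf.isRiemannianLocalIsometry.curvatureDerivNormLE (hV p)⟩
  · obtain ⟨C, hC, hinjrad⟩ := (hM k).2
    refine ⟨min C (δ / 2), by positivity, hsurj.forall.2 fun p => le_sSup fun r hr hrC => ?_⟩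
    obtain ⟨hrC, hrδ⟩ := lt_min_iff.1 ((ENNReal.ofReal_lt_ofReal_iff_of_nonneg hr.le).1 hrC)
    refine hf.expIsDiffeoOnBall (ExpIsDiffeoOnBall.of_lt_injectivityRadius hr
      (((ENNReal.ofReal_lt_ofReal_iff hC).2 hrC).trans_le (hinjrad p))) fun x hx y hy hxy => ?_
    refine hinj x y hxy ?_
    simp only [mem_ofPred_eq, ← IsRiemannianManifold.out (I := 𝓘(ℝ, E))] at hx hy
    calc edist x y ≤ edist p x + edist p y := edist_triangle_left _ _ _
      _ ≤ ENNReal.ofReal r + ENNReal.ofReal r := add_le_add hx.le hy.le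
      _ = ENNReal.ofReal (r + r) := (ENNReal.ofReal_add hr.le hr.le).symm
      _ ≤ ENNReal.ofReal δ := ENNReal.ofReal_le_ofReal (by linarith)

/-- If `f x = f p` and `x` is closer to `p` than the injectivity radii at `p` and `f p`, then
`x = p`: writing `x = exp_p v`, the vectors `df v` and `0` have the same image `f p` under
the exponential map at `f p`. -/
lemma IsRiemannianLocalIsometry.eq_of_riemannianEDist_lt [FiniteDimensional ℝ E]
    [IsManifold 𝓘(ℝ, E) ∞ M]
    [IsContMDiffRiemannianBundle 𝓘(ℝ, E) ∞ E (fun x : M => TangentSpace 𝓘(ℝ, E) x)]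
    {N : Type*} [TopologicalSpace N] [T2Space N] [ChartedSpace E N] [IsManifold 𝓘(ℝ, E) ∞ N]
    [RiemannianBundle (fun x : N => TangentSpace 𝓘(ℝ, E) x)]
    [IsContMDiffRiemannianBundle 𝓘(ℝ, E) ∞ E (fun x : N => TangentSpace 𝓘(ℝ, E) x)]
    {f : M → N} (hf : IsRiemannianLocalIsometry E f) {p x : M} {r : ℝ} (hr : 0 < r)
    (hp : ExpIsDiffeoOnBall E p r) (hfp : ExpIsDiffeoOnBall E (f p) r) (hfx : f x = f p)
    (hx : riemannianEDist 𝓘(ℝ, E) p x < ENNReal.ofReal r) : x = p := by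
  obtain ⟨hgeo, Φ, hΦs, hΦt, hΦ⟩ := hp
  obtain ⟨-, Ψ, hΨs, -, hΨ⟩ := hfp
  obtain ⟨v, hv, rfl⟩ : ∃ v ∈ Φ.source, Φ v = x := by
    have : x ∈ Φ.target := by rw [hΦt]; exact hx
    exact ⟨Φ.symm x, Φ.map_target this, Φ.right_inv this⟩
  rw [hΦs] at hv
  have hdv : ‖mfderiv 𝓘(ℝ, E) 𝓘(ℝ, E) f p v‖ < r := (hf.norm_mfderiv p v).trans_lt hv
  have h0 : ‖(0 : TangentSpace 𝓘(ℝ, E) (f p))‖ < r := by rwa [norm_zero]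
  have hexp : riemannianExp (f p) (mfderiv 𝓘(ℝ, E) 𝓘(ℝ, E) f p v) =
      riemannianExp (f p) (0 : TangentSpace 𝓘(ℝ, E) (f p)) := by
    rw [hf.riemannianExp_mfderiv (hgeo v hv),
      (isGeodesicFrom_const (E := E) (f p)).riemannianExp_eq, ← hfx]
    exact congrArg f (hΦ v hv).symm
  rw [← hΨ _ hdv, ← hΨ _ h0] at hexp
  have hdv0 : mfderiv 𝓘(ℝ, E) 𝓘(ℝ, E) f p v = 0 :=
    Ψ.injOn (by rw [hΨs]; exact hdv) (by rw [hΨs]; exact h0) hexp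
  have hv0 : v = (0 : TangentSpace 𝓘(ℝ, E) p) := by
    have := hf.norm_mfderiv p v
    rw [hdv0, norm_zero] at this
    exact (norm_eq_zero (E := TangentSpace 𝓘(ℝ, E) p)).1 this.symm
  have h0' : ‖(0 : TangentSpace 𝓘(ℝ, E) p)‖ < r := by rwa [norm_zero]
  rw [hv0]
  exact (hΦ 0 h0').trans (isGeodesicFrom_const (E := E) p).riemannianExp_eq

end Action

theorem mainTheorem10 {E : Type*} [NormedAddCommGroup E] [NormedSpace ℝ E] [FiniteDimensional ℝ E]
    {M : Type*} [EMetricSpace M] [ChartedSpace E M] [IsManifold 𝓘(ℝ, E) ∞ M]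
    [RiemannianBundle (fun x : M => TangentSpace 𝓘(ℝ, E) x)]
    [IsContMDiffRiemannianBundle 𝓘(ℝ, E) ∞ E (fun x : M => TangentSpace 𝓘(ℝ, E) x)]
    [IsRiemannianManifold 𝓘(ℝ, E) M]
    {Γ : Type*} [Group Γ] [MulAction Γ M]
    (hisom : ActsByIsometries E Γ M)
    (hfree : ∀ (γ : Γ) (p : M), γ • p = p → γ = 1)
    (hM : HasBoundedGeometry E M) :
    IsFUPD Γ M ↔ QuotientHasBoundedGeometry E Γ M := by
  have hcont : ContinuousConstSMul Γ M := ⟨fun γ => (hisom.contMDiff_smul γ).continuous⟩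
  constructor
  · rintro ⟨-, hpd, δ, hδ, hunif⟩
    have : LocallyCompactSpace M := Manifold.locallyCompact_of_finiteDimensional 𝓘(ℝ, E)
    have : IsCancelSMul Γ M := isCancelSMul_iff_eq_one_of_smul_eq.2 hfree
    have hq : IsQuotientCoveringMap (Quotient.mk (MulAction.orbitRel Γ M)) Γ :=
      isQuotientCoveringMap_quotientMk_of_properlyDiscontinuousSMul
    have hT2 : T2Space (MulAction.orbitRel.Quotient Γ M) := inferInstance
    obtain ⟨_, hman, hloc⟩ := hq.exists_isManifold hisom.contMDiff_smul
    have horbit {x y : M} (hxy : Quotient.mk (MulAction.orbitRel Γ M) x = Quotient.mk _ y) :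
        ∃ γ : Γ, γ • x = y := hq.apply_eq_iff_mem_orbit.1 hxy.symm
    obtain ⟨_, hiso⟩ := hloc.exists_riemannianBundle hq.surjective fun x y hxy => by
      obtain ⟨γ, hγ⟩ := horbit hxy
      exact ⟨fun z => γ • z, (hisom.isRiemannianLocalIsometry γ).mdifferentiableAt x,
        hisom.inner_mfderiv_smul γ x, hγ, funext fun z => hq.map_smul γ⟩
    have hsmooth := hiso.isContMDiffRiemannianBundle hq.surjective
    have hcov : IsRiemannianCovering E (Quotient.mk (MulAction.orbitRel Γ M)) :=
      ⟨hq.isCoveringMap, hloc, hiso.inner_mfderiv⟩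
    refine ⟨hT2, inferInstance, hman, inferInstance, hsmooth, hcov,
      hcov.hasBoundedGeometry hq.surjective hM hδ fun x y hxy hd => ?_⟩
    obtain ⟨γ, rfl⟩ := horbit hxy
    exact hunif x γ hd
  · rintro ⟨hT2, _, hman, _, hsmooth, hcov, hN⟩
    obtain ⟨C₁, hC₁, hinj₁⟩ := (hM 0).2
    obtain ⟨C₂, hC₂, hinj₂⟩ := (hN 0).2
    obtain ⟨r, hr, hrC⟩ := exists_between (lt_min hC₁ hC₂)
    have hunif (p : M) (γ : Γ) (hd : edist p (γ • p) < ENNReal.ofReal r) : p = γ • p := by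
      rw [IsRiemannianManifold.out (I := 𝓘(ℝ, E)) p (γ • p)] at hd
      refine (hcov.isRiemannianLocalIsometry.eq_of_riemannianEDist_lt hr ?_ ?_ ?_ hd).symm
      · exact .of_lt_injectivityRadius hr (((ENNReal.ofReal_lt_ofReal_iff hC₁).2
          (hrC.trans_le (min_le_left _ _))).trans_le (hinj₁ p))
      · exact .of_lt_injectivityRadius hr (((ENNReal.ofReal_lt_ofReal_iff hC₂).2
          (hrC.trans_le (min_le_right _ _))).trans_le (hinj₂ _))
      · exact Quotient.sound ⟨γ, rfl⟩
    refine ⟨hfree, properlyDiscontinuousSMul_of_uniform hfree (hisom.edist_smul_le)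
      (ENNReal.ofReal_pos.2 hr) hunif, r / 2, by positivity, fun p γ hd => hunif p γ ?_⟩
    exact hd.trans_lt ((ENNReal.ofReal_lt_ofReal_iff hr).2 (by linarith))
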